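/- Let $\mu=\mu_0\delta_0+\mu_1\delta_1$ be a probability distribution on $\{0,1\}$ and let $(p_{ij})_{i,j\in\{0,1\}}$ be a stochastic matrix with $p_{ij}<1$ for all $i,j$. For $n\ge 1$ let $n$ independent infinite binary strings be given, each of them a homogeneous Markov chain on $\{0,1\}$ with initial distribution $\mu$ and transition matrix $(p_{ij})$, and let a rank be given that is uniformly distributed on $\{1,\dots,n\}$ and independent of the strings. Radix Selection with two buckets finds the string of this rank (in lexicographic order) as follows: while the current bucket (at first all $n$ strings) contains at least two strings, all its strings are distributed into two buckets according to their next digit, and the algorithm proceeds with the one that contains the sought string. Each assignment of a string to a bucket is one bucket operation. Let $W_n$ be the total number of bucket operations. Then $W_n$ is almost surely finite with finite mean, and, as $n\to\infty$, $$\mathbb{E}[W_n]=\kappa_\mu n+o(n),\qquad \kappa_\mu:=\mu_0^2\kappa_0+(1-\mu_0)^2\kappa_1+1>0,$$ where $$\kappa_0=\frac{1+p_{01}^2-p_{11}^2}{2(p_{00}+p_{11})(1+p_{00}p_{11})-2(p_{00}+p_{11})^2}>0,\qquad \kappa_1=\frac{1+p_{10}^2-p_{00}^2}{2(p_{00}+p_{11})(1+p_{00}p_{11})-2(p_{00}+p_{11})^2}>0.$$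 Moreover, there is exactly one pair of probability laws on $\mathbb{R}$ of integrable random variables $Z^0,Z^1$ that solves the system $$Z^i\stackrel{d}{=}B_{p_{i0}}\,p_{i0}Z^0+(1-B_{p_{i0}})(1-p_{i0})Z^1+1,\qquad i=0,1,$$ where, for each $i$, the variables $B_{p_{i0}},Z^0,Z^1$ on the right-hand side are independent and $B_q$ denotes a Bernoulli variable with success probability $q$; and $\mathbb{E}[Z^i]=\kappa_i$ for $i=0,1$. With these laws, as $n\to\infty$, $$\frac{W_n}{n}\stackrel{d}{\longrightarrow}Z_\mu\stackrel{d}{=}B_{\mu_0}\,\mu_0Z^0+(1-B_{\mu_0})(1-\mu_0)Z^1+1,$$ where $B_{\mu_0},Z^0,Z^1$ are independent, and the convergence holds with all moments: for every $k\in\mathbb{N}$ the $k$-th moments of $W_n/n$ and of $Z_\mu$ are finite and $\mathbb{E}[(W_n/n)^k]\to\mathbb{E}[Z_\mu^k]$. -/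

import Mathlib

open MeasureTheory ProbabilityTheory Filter Topology
open scoped ENNReal

noncomputable section

namespace RadixSelection

/-- One partitioning stage on binary strings `x 0, …, x (n-1)`. The state is the set of indices of
the data in the current bucket together with the rank of the sought datum inside this bucket.
Stage `k` reads digit number `k` (digits are numbered from `0`) of each datum of the bucket and
passes to the sub-bucket that contains the sought rank. -/
def step {n : ℕ} (x : Fin n → ℕ → Fin 2) (k : ℕ) (s : Finset (Fin n) × ℕ) :
    Finset (Fin n) × ℕ :=
  if s.2 ≤ (s.1.filter fun i => x i k = 0).card then
    (s.1.filter fun i => x i k = 0, s.2)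
  else
    (s.1.filter fun i => x i k = 1, s.2 - (s.1.filter fun i => x i k = 0).card)

/-- The bucket and the rank inside it before stage `k`, when rank `ℓ` is to be selected. -/
def state {n : ℕ} (x : Fin n → ℕ → Fin 2) (ℓ : ℕ) : ℕ → Finset (Fin n) × ℕ
  | 0 => (Finset.univ, ℓ)
  | k + 1 => step x k (state x ℓ k)

/-- The number of bucket operations of Radix Selection with two buckets selecting rank `ℓ`
(`1 ≤ ℓ ≤ n`): a stage that starts with a bucket of `m ≥ 2` data costs `m` operations, and the
algorithm stops as soon as the current bucket contains no further datum. The value is `∞` if the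
algorithm does not stop. -/
def bucketOps {n : ℕ} (x : Fin n → ℕ → Fin 2) (ℓ : ℕ) : ℝ≥0∞ :=
  ∑' k : ℕ, if 2 ≤ (state x ℓ k).1.card then ((state x ℓ k).1.card : ℝ≥0∞) else 0

/-- The random string `X` is a homogeneous Markov chain on `{0, 1}` with initial distribution `μ`
and transition matrix `p`. -/
def IsMarkovChain {Ω : Type*} [MeasurableSpace Ω] (P : Measure Ω) (μ : Fin 2 → ℝ)
    (p : Matrix (Fin 2) (Fin 2) ℝ) (X : Ω → ℕ → Fin 2) : Prop :=
  ∀ (k : ℕ) (s : ℕ → Fin 2),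
    P {ω | ∀ j ≤ k, X ω j = s j} =
      ENNReal.ofReal (μ (s 0) * ∏ j ∈ Finset.range k, p (s j) (s (j + 1)))

/-- The data `X` are `n` independent strings, each generated by the Markov source `(μ, p)`, and
the rank `R` is uniformly distributed on `{1, …, n}` and independent of the data. -/
structure IsUniformRankModel {Ω : Type*} [MeasurableSpace Ω] (P : Measure Ω) (μ : Fin 2 → ℝ)
    (p : Matrix (Fin 2) (Fin 2) ℝ) (n : ℕ) (X : Fin n → Ω → ℕ → Fin 2) (R : Ω → ℕ) : Prop where
  measurable_data : ∀ i, Measurable (X i)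
  markov_data : ∀ i, IsMarkovChain P μ p (X i)
  indep_data : iIndepFun X P
  measurable_rank : Measurable R
  uniform_rank : ∀ ℓ ∈ Finset.Icc 1 n, P {ω | R ω = ℓ} = (n : ℝ≥0∞)⁻¹
  indep_rank : IndepFun (fun ω i => X i ω) R P

/-- The Bernoulli distribution with success probability `q`, as a law on `ℝ`. -/
def bernoulliLaw (q : ℝ) : Measure ℝ :=
  ENNReal.ofReal q • Measure.dirac 1 + ENNReal.ofReal (1 - q) • Measure.dirac 0

/-- The law of `B q Z⁰ + (1 - B) (1 - q) Z¹ + 1`, where `B, Z⁰, Z¹` are independent, `B` is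
Bernoulli with success probability `q`, and `Z⁰, Z¹` have laws `ν₀, ν₁`. -/
def mixLaw (q : ℝ) (ν₀ ν₁ : Measure ℝ) : Measure ℝ :=
  ((bernoulliLaw q).prod (ν₀.prod ν₁)).map
    fun t => t.1 * q * t.2.1 + (1 - t.1) * (1 - q) * t.2.2 + 1

/-- The laws `ν 0, ν 1` of `Z⁰, Z¹` are integrable and solve
`Zⁱ =ᵈ B_{p i 0} p_{i0} Z⁰ + (1 - B_{p i 0}) (1 - p_{i0}) Z¹ + 1` for `i = 0, 1`. -/
def IsIntegrableSolution (p : Matrix (Fin 2) (Fin 2) ℝ) (ν : Fin 2 → ProbabilityMeasure ℝ) :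
    Prop :=
  ∀ i, Integrable (fun x : ℝ => x) (ν i : Measure ℝ) ∧
    (ν i : Measure ℝ) = mixLaw (p i 0) (ν 0 : Measure ℝ) (ν 1 : Measure ℝ)

/-- The common denominator of the constants `κ₀, κ₁`. -/
def kappaDenom (p : Matrix (Fin 2) (Fin 2) ℝ) : ℝ :=
  2 * (p 0 0 + p 1 1) * (1 + p 0 0 * p 1 1) - 2 * (p 0 0 + p 1 1) ^ 2

/-- The constant `κ₀`. -/
def kappa0 (p : Matrix (Fin 2) (Fin 2) ℝ) : ℝ :=
  (1 + p 0 1 ^ 2 - p 1 1 ^ 2) / kappaDenom p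

/-- The constant `κ₁`. -/
def kappa1 (p : Matrix (Fin 2) (Fin 2) ℝ) : ℝ :=
  (1 + p 1 0 ^ 2 - p 0 0 ^ 2) / kappaDenom p

/-- The constant `κ_μ`. -/
def kappa (μ : Fin 2 → ℝ) (p : Matrix (Fin 2) (Fin 2) ℝ) : ℝ :=
  μ 0 ^ 2 * kappa0 p + (1 - μ 0) ^ 2 * kappa1 p + 1

end RadixSelection

end

/-
While the search follows the string number `j`, every other string is moved once in each stage that
it shares with string `j`, and string `j` itself is moved until it is alone. So the cost is the sum
plus the maximum of the numbers of shared stages. Averaging over the uniform rank and exchanging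
the strings, `W_{n+1}` has the law of the cost of following one fixed string `y` in the company of
`n` independent copies.

Given `y`, the strong law of large numbers sends the sum divided by `n` to the expected number of
shared stages, which is `∑ k, κ (cylinder y k)` for the law `κ` of the strings, while the maximum
is negligible. Since all transition probabilities are less than `1`, cylinders have geometrically
small probability, whence uniform integrability of all powers and convergence of all moments.

Splitting off the first digit of `y` turns the sum over cylinders into the fixed-point system. Its
solution is unique because the system contracts the arguments of the characteristic functions
towards `0`, and the means of a solution satisfy two linear equations.
-/

noncomputable section

namespace RadixSelection

/-! ### Following one string -/

section SharedStages

variable {α : Type*} {n : ℕ}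

/-- The number of stages in which two distinct strings share a bucket, which is one more than the
length of their longest common prefix. -/
def sharedStages (x y : ℕ → α) : ℕ := PiNat.firstDiff x y + 1

lemma mem_cylinder_iff_lt_sharedStages {x y : ℕ → α} (h : x ≠ y) (k : ℕ) :
    x ∈ PiNat.cylinder y k ↔ k < sharedStages x y := by
  rw [PiNat.mem_cylinder_iff_le_firstDiff h, sharedStages, Nat.lt_succ_iff]

/-- The number of bucket operations when the search follows the string number `j`: every other
string is moved in each stage that it shares with string `j`, and string `j` itself is moved as
long as it is not alone. -/
def followCost (x : Fin n → ℕ → α) (j : Fin n) : ℕ :=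
  ∑ i ∈ Finset.univ.erase j, sharedStages (x i) (x j) +
    (Finset.univ.erase j).sup fun i => sharedStages (x i) (x j)

lemma followCost_comp_perm (x : Fin n → ℕ → α) (σ : Equiv.Perm (Fin n)) (j : Fin n) :
    followCost (x ∘ σ) j = followCost x (σ j) := by
  have herase : Finset.univ.erase (σ j) = (Finset.univ.erase j).map σ.toEmbedding := by
    rw [Finset.map_erase, Finset.map_univ_equiv, Equiv.coe_toEmbedding]
  simp only [followCost, herase, Finset.sum_map, Finset.sup_map, Equiv.coe_toEmbedding,
    Function.comp_apply, Function.comp_def]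

/-- The set of strings that agree with string number `j` in the first `k` digits. -/
def prefixClass (x : Fin n → ℕ → α) (j : Fin n) (k : ℕ) : Finset (Fin n) :=
  open Classical in Finset.univ.filter fun i => x i ∈ PiNat.cylinder (x j) k

lemma mem_prefixClass {x : Fin n → ℕ → α} {i j : Fin n} {k : ℕ} :
    i ∈ prefixClass x j k ↔ ∀ m < k, x i m = x j m := by
  simp [prefixClass, PiNat.mem_cylinder_iff]

lemma prefixClass_eq_insert {x : Fin n → ℕ → α} (hx : Function.Injective x) (j : Fin n) (k : ℕ) :
    prefixClass x j k =
      insert j ((Finset.univ.erase j).filter fun i => k < sharedStages (x i) (x j)) := by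
  ext i
  by_cases hij : i = j
  · simp [hij, mem_prefixClass]
  · simp [prefixClass, hij, mem_cylinder_iff_lt_sharedStages (hx.ne hij)]

lemma exists_prefixClass_eq_singleton {x : Fin n → ℕ → α} (hx : Function.Injective x) :
    ∃ K, ∀ j, prefixClass x j K = {j} := by
  refine ⟨Finset.univ.sup fun q : Fin n × Fin n => sharedStages (x q.1) (x q.2), fun j => ?_⟩
  rw [prefixClass_eq_insert hx, Finset.filter_false_of_mem fun i _ => not_lt.mpr ?_]
  · rfl
  · exact Finset.le_sup (f := fun q : Fin n × Fin n => sharedStages (x q.1) (x q.2))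
      (Finset.mem_univ (i, j))

lemma tsum_ite_lt (a : ℕ) : ∑' k : ℕ, (if k < a then (1 : ℝ≥0∞) else 0) = a := by
  rw [tsum_eq_sum (s := Finset.range a) fun k hk => by simpa using hk,
    Finset.sum_congr rfl fun k hk => if_pos (Finset.mem_range.mp hk)]
  simp

lemma stageCost_prefixClass {x : Fin n → ℕ → α} (hx : Function.Injective x) (j : Fin n) (k : ℕ) :
    (if 2 ≤ (prefixClass x j k).card then ((prefixClass x j k).card : ℝ≥0∞) else 0) =
      ∑ i ∈ Finset.univ.erase j, (if k < sharedStages (x i) (x j) then 1 else 0) +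
      if k < (Finset.univ.erase j).sup fun i => sharedStages (x i) (x j) then 1 else 0 := by
  rw [prefixClass_eq_insert hx, Finset.card_insert_of_notMem (by simp), Finset.sum_boole]
  simp only [Finset.lt_sup_iff, ← Finset.filter_nonempty_iff, ← Finset.card_pos]
  set s := (Finset.univ.erase j).filter fun i => k < sharedStages (x i) (x j)
  rcases Nat.eq_zero_or_pos s.card with h | h
  · simp [h]
  · rw [if_pos (by omega), if_pos h, Nat.cast_add_one]

lemma tsum_stageCost_prefixClass {x : Fin n → ℕ → α} (hx : Function.Injective x) (j : Fin n) :
    ∑' k : ℕ, (if 2 ≤ (prefixClass x j k).card then ((prefixClass x j k).card : ℝ≥0∞) else 0) =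
      followCost x j := by
  simp_rw [stageCost_prefixClass hx, ENNReal.summable.tsum_add ENNReal.summable,
    Summable.tsum_finsetSum fun _ _ => ENNReal.summable, tsum_ite_lt, followCost, Nat.cast_add,
    Nat.cast_sum]

end SharedStages

section States

variable {n : ℕ} {x : Fin n → ℕ → Fin 2} {ℓ ℓ' k : ℕ} {j : Fin n}

lemma card_filter_digit (x : Fin n → ℕ → Fin 2) (k : ℕ) (C : Finset (Fin n)) :
    (C.filter fun i => x i k = 0).card + (C.filter fun i => x i k = 1).card = C.card := by
  simp only [← Finset.card_filter_add_card_filter_not (s := C) (fun i => x i k = 0),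
    show ∀ a : Fin 2, ¬ a = 0 ↔ a = 1 by decide]

lemma state_fst_antitone (x : Fin n → ℕ → Fin 2) (ℓ : ℕ) : Antitone fun k => (state x ℓ k).1 := by
  refine antitone_nat_of_succ_le fun k => ?_
  rw [state, step]
  split_ifs <;> exact Finset.filter_subset _ _

lemma mem_state_fst_of_succ (hj : j ∈ (state x ℓ (k + 1)).1) : j ∈ (state x ℓ k).1 :=
  state_fst_antitone x ℓ k.le_succ hj

lemma state_rank_bounds (x : Fin n → ℕ → Fin 2) (hℓ : ℓ ∈ Finset.Icc 1 n) (k : ℕ) :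
    1 ≤ (state x ℓ k).2 ∧ (state x ℓ k).2 ≤ (state x ℓ k).1.card := by
  induction k with
  | zero => simpa [state] using hℓ
  | succ k ih =>
    have hcard := card_filter_digit x k (state x ℓ k).1
    rw [state, step]
    split_ifs with h
    · exact ⟨ih.1, h⟩
    · dsimp only
      omega

lemma state_fst_nonempty (x : Fin n → ℕ → Fin 2) (hℓ : ℓ ∈ Finset.Icc 1 n) (k : ℕ) :
    (state x ℓ k).1.Nonempty :=
  Finset.card_pos.mp ((state_rank_bounds x hℓ k).1.trans (state_rank_bounds x hℓ k).2)

lemma state_fst_eq_prefixClass (hj : j ∈ (state x ℓ k).1) :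
    (state x ℓ k).1 = prefixClass x j k := by
  induction k with
  | zero => ext i; simp [state, mem_prefixClass]
  | succ k ih =>
    have hfilter : ∀ a : Fin 2, x j k = a →
        ((state x ℓ k).1.filter fun i => x i k = a) = prefixClass x j (k + 1) := by
      rintro a rfl
      ext i
      rw [Finset.mem_filter, ih (mem_state_fst_of_succ hj), mem_prefixClass, mem_prefixClass,
        Nat.forall_lt_succ_right]
    rw [state, step] at hj ⊢
    split_ifs at hj ⊢ with h
    · exact hfilter 0 (Finset.mem_filter.mp hj).2
    · exact hfilter 1 (Finset.mem_filter.mp hj).2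

/-- The state after a stage determines the state before it, since all data of the new bucket
agree in the digit just read. -/
lemma eq_rank_of_state_succ_eq (hfst : (state x ℓ k).1 = (state x ℓ' k).1)
    (hj : j ∈ (state x ℓ (k + 1)).1) (h : state x ℓ (k + 1) = state x ℓ' (k + 1)) :
    (state x ℓ k).2 = (state x ℓ' k).2 := by
  have hj' := h ▸ hj
  simp only [state, step] at h hj hj'
  rw [← hfst] at h hj'
  split_ifs at h hj hj' with h₁ h₂ h₂
  · exact (Prod.ext_iff.mp h).2
  · exact absurd ((Finset.mem_filter.mp hj).2.symm.trans (Finset.mem_filter.mp hj').2) (by decide)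
  · exact absurd ((Finset.mem_filter.mp hj).2.symm.trans (Finset.mem_filter.mp hj').2) (by decide)
  · have hsub := congrArg Prod.snd h
    dsimp only at hsub
    omega

lemma state_injOn (x : Fin n → ℕ → Fin 2) (k : ℕ) :
    Set.InjOn (fun ℓ => state x ℓ k) (Finset.Icc 1 n : Finset ℕ) := by
  induction k with
  | zero => intro a _ b _ h; simpa [state] using h
  | succ k ih =>
    intro a ha b hb (h : state x a (k + 1) = state x b (k + 1))
    obtain ⟨j, hj⟩ := state_fst_nonempty x ha (k + 1)
    have hfst : (state x a k).1 = (state x b k).1 := by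
      rw [state_fst_eq_prefixClass (mem_state_fst_of_succ hj),
        state_fst_eq_prefixClass (mem_state_fst_of_succ (h ▸ hj))]
    exact ih ha hb (Prod.ext hfst (eq_rank_of_state_succ_eq hfst hj h))

lemma exists_forall_mem_state_fst (hx : Function.Injective x) (hℓ : ℓ ∈ Finset.Icc 1 n) :
    ∃ j, ∀ k, j ∈ (state x ℓ k).1 := by
  obtain ⟨K, hK⟩ := exists_prefixClass_eq_singleton hx
  obtain ⟨j, hj⟩ := state_fst_nonempty x hℓ K
  refine ⟨j, fun k => ?_⟩
  rcases le_total k K with hkK | hKk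
  · exact state_fst_antitone x ℓ hkK hj
  · obtain ⟨i, hi⟩ := state_fst_nonempty x hℓ k
    have hij := state_fst_antitone x ℓ hKk hi
    dsimp only at hij
    rw [state_fst_eq_prefixClass hj, hK, Finset.mem_singleton] at hij
    rwa [← hij]

lemma eq_of_forall_mem_state_fst (hx : Function.Injective x) (hℓ : ℓ ∈ Finset.Icc 1 n)
    (hℓ' : ℓ' ∈ Finset.Icc 1 n) (h : ∀ k, j ∈ (state x ℓ k).1) (h' : ∀ k, j ∈ (state x ℓ' k).1) :
    ℓ = ℓ' := by
  obtain ⟨K, hK⟩ := exists_prefixClass_eq_singleton hx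
  have hsingle : ∀ m ∈ Finset.Icc 1 n, (∀ k, j ∈ (state x m k).1) → state x m K = ({j}, 1) := by
    intro m hm hjm
    have hfst : (state x m K).1 = {j} := (state_fst_eq_prefixClass (hjm K)).trans (hK j)
    have hrank := state_rank_bounds x hm K
    rw [hfst, Finset.card_singleton] at hrank
    exact Prod.ext hfst (hrank.2.antisymm hrank.1)
  exact state_injOn x K hℓ hℓ' ((hsingle ℓ hℓ h).trans (hsingle ℓ' hℓ' h').symm)

lemma bucketOps_eq_followCost (hx : Function.Injective x) (h : ∀ k, j ∈ (state x ℓ k).1) :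
    bucketOps x ℓ = followCost x j := by
  rw [← tsum_stageCost_prefixClass hx, bucketOps]
  exact tsum_congr fun k => by rw [state_fst_eq_prefixClass (h k)]

/-- The sought datum is a bijective function of the rank. -/
lemma sum_bucketOps {M : Type*} [AddCommMonoid M] (hx : Function.Injective x) (F : ℝ≥0∞ → M) :
    ∑ ℓ ∈ Finset.Icc 1 n, F (bucketOps x ℓ) = ∑ j, F (followCost x j) := by
  choose f hf using fun ℓ (hℓ : ℓ ∈ Finset.Icc 1 n) => exists_forall_mem_state_fst hx hℓ
  have hinj : ∀ ℓ hℓ ℓ' hℓ', f ℓ hℓ = f ℓ' hℓ' → ℓ = ℓ' := fun ℓ hℓ ℓ' hℓ' h =>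
    eq_of_forall_mem_state_fst hx hℓ hℓ' (hf ℓ hℓ) (h ▸ hf ℓ' hℓ')
  refine Finset.sum_bij f (fun _ _ => Finset.mem_univ _) hinj (fun j hj => ?_)
    fun ℓ hℓ => by rw [bucketOps_eq_followCost hx (hf ℓ hℓ)]
  exact Finset.surj_on_of_inj_on_of_card_le f (fun _ _ => Finset.mem_univ _)
    (fun ℓ ℓ' hℓ hℓ' => hinj ℓ hℓ ℓ' hℓ') (by simp) j hj |>.imp fun ℓ h => ⟨h.1, h.2.symm⟩

end States

/-! ### Probabilistic tools -/

section Tools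

variable {Ω β : Type*} [MeasurableSpace Ω] [MeasurableSpace β]

lemma integrable_pow_of_geometric_tail {P : Measure Ω} {T : Ω → ℕ} (hT : Measurable T)
    {C ρ : NNReal} (hρ : ρ < 1) (htail : ∀ k, P {ω | k ≤ T ω} ≤ C * ρ ^ k) (m : ℕ) :
    Integrable (fun ω => (T ω : ℝ) ^ m) P := by
  have hsum : Summable fun k : ℕ => (k : NNReal) ^ m * (C * ρ ^ k) := by
    rw [← NNReal.summable_coe]
    push_cast
    simpa only [mul_left_comm] using (summable_pow_mul_geometric_of_norm_lt_one (R := ℝ) m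
      (by simpa using hρ)).mul_left (C : ℝ)
  have hatom : ∀ k, P.map T {k} ≤ C * ρ ^ k := fun k => by
    rw [Measure.map_apply hT (measurableSet_singleton k)]
    exact (measure_mono fun ω (hω : T ω = k) => hω.ge).trans (htail k)
  have hint : Integrable (fun k : ℕ => (k : ℝ) ^ m) (P.map T) := by
    refine ⟨Measurable.of_discrete.aestronglyMeasurable, ?_⟩
    rw [HasFiniteIntegral, lintegral_countable']
    calc ∑' k : ℕ, ‖(k : ℝ) ^ m‖ₑ * P.map T {k}
        ≤ ∑' k : ℕ, (((k : NNReal) ^ m * (C * ρ ^ k) : NNReal) : ℝ≥0∞) := by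
          refine ENNReal.tsum_le_tsum fun k => ?_
          push_cast
          gcongr
          · simp
          · exact hatom k
      _ < ∞ := (ENNReal.tsum_coe_ne_top_iff_summable.mpr hsum).lt_top
  exact hint.comp_measurable hT

lemma measurable_finset_sup {ι : Type*} (s : Finset ι) {f : ι → Ω → ℕ}
    (hf : ∀ i, Measurable (f i)) : Measurable fun ω => s.sup fun i => f i ω := by
  classical
  induction s using Finset.induction_on with
  | empty => exact measurable_const
  | insert i s _ ih =>
    simp only [Finset.sup_insert]
    exact (hf i).sup ih

lemma lintegral_natCast_eq_tsum (P : Measure Ω) {T : Ω → ℕ} (hT : Measurable T) :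
    ∫⁻ ω, (T ω : ℝ≥0∞) ∂P = ∑' k : ℕ, P {ω | k < T ω} := by
  have hset : ∀ k, MeasurableSet {ω | k < T ω} := fun k => hT measurableSet_Ioi
  have hind : ∀ ω, (T ω : ℝ≥0∞) = ∑' k : ℕ, Set.indicator {ω | k < T ω} 1 ω := fun ω => by
    simp only [Set.indicator_apply, Set.mem_ofPred_eq, Pi.one_apply, tsum_ite_lt]
  simp_rw [hind]
  rw [lintegral_tsum fun k => (measurable_one.indicator (hset k)).aemeasurable]
  exact tsum_congr fun k => lintegral_indicator_one (hset k)

lemma identDistrib_comp_of_measurePreserving {γ : Type*} [MeasurableSpace γ] {P : Measure Ω}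
    {κ : Measure β} {φ : Ω → β} (hφ : MeasurePreserving φ P κ) {f : β → γ} (hf : Measurable f) :
    IdentDistrib (f ∘ φ) f P κ :=
  ⟨(hf.comp hφ.measurable).aemeasurable, hf.aemeasurable, by
    rw [← hφ.map_eq, Measure.map_map hf hφ.measurable]⟩

lemma ae_tendsto_average_infinitePi (κ : Measure β) [IsProbabilityMeasure κ] {f : β → ℝ}
    (hf : Measurable f) (hint : Integrable f κ) :
    ∀ᵐ x ∂Measure.infinitePi fun _ : ℕ => κ,
      Tendsto (fun n : ℕ => (∑ i ∈ Finset.range n, f (x i)) / n) atTop (𝓝 (∫ b, f b ∂κ)) := by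
  set ξ : ℕ → (ℕ → β) → ℝ := fun i x => f (x i)
  have hident : ∀ i, IdentDistrib (ξ i) f (Measure.infinitePi fun _ => κ) κ := fun i =>
    identDistrib_comp_of_measurePreserving (measurePreserving_eval_infinitePi (fun _ => κ) i) hf
  have hindep : iIndepFun ξ (Measure.infinitePi fun _ => κ) :=
    iIndepFun_infinitePi (X := fun _ => f) fun _ => hf
  have hlaw := strong_law_ae_real ξ ((hident 0).integrable_iff.mpr hint)
    (fun _ _ hij => hindep.indepFun hij) fun i => (hident i).trans (hident 0).symm
  rwa [(hident 0).integral_eq] at hlaw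

lemma uniformIntegrable_of_norm_le {ι ι' E F : Type*} [NormedAddCommGroup E] [NormedAddCommGroup F]
    {P : Measure Ω} {p : ℝ≥0∞} {f : ι → Ω → E} {g : ι' → Ω → F} (hg : UniformIntegrable g p P)
    (hf : ∀ i, AEStronglyMeasurable (f i) P) (hfg : ∀ i, ∃ j, ∀ ω, ‖f i ω‖ ≤ ‖g j ω‖) :
    UniformIntegrable f p P := by
  choose j hj using hfg
  refine ⟨hf, fun ε hε => ?_, hg.2.2.imp fun C hC i => (eLpNorm_mono (hj i)).trans (hC (j i))⟩
  obtain ⟨δ, hδ, h⟩ := hg.2.1 hε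
  refine ⟨δ, hδ, fun i s hs hPs => (eLpNorm_mono fun ω => ?_).trans (h (j i) s hs hPs)⟩
  rw [norm_indicator_eq_indicator_norm, norm_indicator_eq_indicator_norm]
  exact Set.indicator_le_indicator (hj i ω)

lemma tendsto_integral_of_uniformIntegrable {P : Measure Ω} [IsFiniteMeasure P] {f : ℕ → Ω → ℝ}
    {g : Ω → ℝ} (hf : UniformIntegrable f 1 P)
    (hfg : ∀ᵐ ω ∂P, Tendsto (fun n => f n ω) atTop (𝓝 (g ω))) :
    Tendsto (fun n => ∫ ω, f n ω ∂P) atTop (𝓝 (∫ ω, g ω ∂P)) := by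
  have hg : MemLp g 1 P := hf.memLp_of_ae_tendsto hfg
  exact tendsto_integral_of_L1' g (memLp_one_iff_integrable.mp hg).aestronglyMeasurable
    (Eventually.of_forall fun n => memLp_one_iff_integrable.mp (hf.memLp n))
    (tendsto_Lp_finite_of_tendsto_ae le_rfl ENNReal.one_ne_top hf.1 hg hf.2.1 hfg)

/-- The square of the maximum is at most the sum of the squares. -/
lemma tendsto_sup_div_of_tendsto_average_sq {a : ℕ → ℕ} {c : ℝ}
    (ha : Tendsto (fun n : ℕ => (∑ i ∈ Finset.range n, (a i : ℝ) ^ 2) / n) atTop (𝓝 c)) :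
    Tendsto (fun n : ℕ => (((Finset.range n).sup a : ℕ) : ℝ) / n) atTop (𝓝 0) := by
  have hle : ∀ n : ℕ, (((Finset.range n).sup a : ℕ) : ℝ) / n ≤
      √((∑ i ∈ Finset.range n, (a i : ℝ) ^ 2) / n * (n : ℝ)⁻¹) := fun n => by
    refine Real.le_sqrt_of_sq_le ?_
    rw [div_pow, sq (n : ℝ), ← div_div, ← div_eq_mul_inv]
    gcongr
    rcases (Finset.range n).eq_empty_or_nonempty with h | h
    · simp [h]
    · obtain ⟨i, hi, hsup⟩ := (Finset.range n).exists_mem_eq_sup h a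
      rw [hsup]
      exact Finset.single_le_sum (f := fun i => (a i : ℝ) ^ 2) (fun i _ => sq_nonneg _) hi
  have hlim := (ha.mul tendsto_inv_atTop_nhds_zero_nat).sqrt
  rw [mul_zero, Real.sqrt_zero] at hlim
  exact squeeze_zero (fun n => by positivity) hle hlim

lemma average_pow_le (a : ℕ → ℝ) (ha : ∀ i, 0 ≤ a i) (n m : ℕ) :
    ((∑ i ∈ Finset.range (n + 1), a i) / (n + 1 : ℕ)) ^ m ≤
      (∑ i ∈ Finset.range (n + 1), a i ^ m) / (n + 1 : ℕ) := by
  simpa only [← Finset.mul_sum, div_eq_inv_mul] using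
    Real.pow_arith_mean_le_arith_mean_pow (Finset.range (n + 1)) (fun _ => ((n + 1 : ℕ) : ℝ)⁻¹) a
      (fun _ _ => by positivity)
      (by rw [Finset.sum_const, Finset.card_range, nsmul_eq_mul]; field_simp)
      (fun i _ => ha i) m

end Tools

/-! ### Independent strings with a common law -/

section CommonLaw

variable {α : Type*}

/-- The number of bucket operations when the search follows the string `q.1` and the other data are
the first `n` strings of the sequence `q.2`. -/
def streamCost (n : ℕ) (q : (ℕ → α) × (ℕ → ℕ → α)) : ℕ :=
  ∑ i ∈ Finset.range n, sharedStages (q.2 i) q.1 +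
    (Finset.range n).sup fun i => sharedStages (q.2 i) q.1

lemma streamCost_le (n : ℕ) (q : (ℕ → α) × (ℕ → ℕ → α)) :
    streamCost n q ≤ ∑ i ∈ Finset.range n, 2 * sharedStages (q.2 i) q.1 := by
  rw [← Finset.mul_sum, two_mul, streamCost]
  gcongr
  exact Finset.sup_le fun i hi => Finset.single_le_sum_of_canonicallyOrdered
    (f := fun i => sharedStages (q.2 i) q.1) hi

variable [MeasurableSpace α]

/-- The law `κ` of a random string gives a prefix of length `k` a mass that is geometrically small
in `k`, uniformly in the prefix. -/
def HasGeometricCylinders (κ : Measure (ℕ → α)) : Prop :=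
  ∃ C ρ : NNReal, ρ < 1 ∧ ∀ y k, κ (PiNat.cylinder y k) ≤ C * ρ ^ k

/-- The expected number of stages that the string `y` shares with a random string of law `κ`. -/
def pathCost (κ : Measure (ℕ → α)) (y : ℕ → α) : ℝ := ∫ x, (sharedStages x y : ℝ) ∂κ

/-- The joint law of the followed string and an infinite supply of other strings, all of them
independent with law `κ`. -/
def streamLaw (κ : Measure (ℕ → α)) : Measure ((ℕ → α) × (ℕ → ℕ → α)) :=
  κ.prod (Measure.infinitePi fun _ => κ)

instance (κ : Measure (ℕ → α)) [IsProbabilityMeasure κ] : IsProbabilityMeasure (streamLaw κ) := by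
  unfold streamLaw
  infer_instance

lemma measurePreserving_streamLaw_eval (κ : Measure (ℕ → α)) [IsProbabilityMeasure κ] (i : ℕ) :
    MeasurePreserving (Prod.map id (Function.eval i)) (streamLaw κ) (κ.prod κ) :=
  (MeasurePreserving.id κ).prod (measurePreserving_eval_infinitePi (fun _ => κ) i)

lemma HasGeometricCylinders.nullSingletonClass {κ : Measure (ℕ → α)}
    (hκ : HasGeometricCylinders κ) : NullSingletonClass κ := by
  obtain ⟨C, ρ, hρ, hcyl⟩ := hκ
  have hlim : Tendsto (fun k : ℕ => (C : ℝ≥0∞) * ρ ^ k) atTop (𝓝 0) := by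
    have h := ENNReal.Tendsto.const_mul (a := (C : ℝ≥0∞))
      (ENNReal.tendsto_pow_atTop_nhds_zero_of_lt_one (ENNReal.coe_lt_one_iff.mpr hρ))
      (Or.inr ENNReal.coe_ne_top)
    rwa [mul_zero] at h
  exact ⟨fun y => le_antisymm (ge_of_tendsto' hlim fun k => (measure_mono
    (Set.singleton_subset_iff.mpr (PiNat.self_mem_cylinder y k))).trans (hcyl y k)) zero_le⟩

lemma HasGeometricCylinders.summable_cylinder {κ : Measure (ℕ → α)}
    (hκ : HasGeometricCylinders κ) (y : ℕ → α) :
    Summable fun k => κ.real (PiNat.cylinder y k) := by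
  obtain ⟨C, ρ, hρ, hcyl⟩ := hκ
  refine .of_nonneg_of_le (fun _ => measureReal_nonneg) (fun k => ?_)
    ((summable_geometric_of_lt_one ρ.2 hρ).mul_left (C : ℝ))
  exact ENNReal.toReal_mono (by finiteness) (hcyl y k)

lemma measure_lt_sharedStages {κ : Measure (ℕ → α)} [NullSingletonClass κ] (y : ℕ → α) (k : ℕ) :
    κ {x | k < sharedStages x y} = κ (PiNat.cylinder y k) := by
  refine measure_congr ?_
  filter_upwards [Measure.ae_ne κ y] with x hx
  exact propext (mem_cylinder_iff_lt_sharedStages hx k).symm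

variable [Countable α] [DiscreteMeasurableSpace α]

lemma measurable_sharedStages : Measurable fun q : (ℕ → α) × (ℕ → α) => sharedStages q.2 q.1 := by
  refine Measurable.add_const (measurable_of_Ioi fun k => ?_) 1
  have hset : (fun q : (ℕ → α) × (ℕ → α) => PiNat.firstDiff q.2 q.1) ⁻¹' Set.Ioi k =
      (Set.diagonal (ℕ → α))ᶜ ∩ ⋂ m ∈ Set.Iio (k + 1), {q | q.2 m = q.1 m} := by
    ext q
    by_cases h : q.2 = q.1
    · simp [h, PiNat.firstDiff_def]
    · have hcyl := PiNat.mem_cylinder_iff_le_firstDiff h (k + 1)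
      rw [PiNat.mem_cylinder_iff] at hcyl
      simp only [Set.mem_preimage, Set.mem_Ioi, ← Nat.succ_le_iff, ← hcyl, Nat.succ_eq_add_one,
        Set.mem_inter_iff, Set.mem_compl_iff, Set.mem_diagonal_iff, Ne.symm h, not_false_eq_true,
        true_and, Set.mem_iInter, Set.mem_Iio, Set.mem_ofPred_eq]
  rw [hset]
  exact measurableSet_diagonal.compl.inter (MeasurableSet.biInter (Set.to_countable _) fun m _ =>
    measurableSet_eq_fun (by fun_prop) (by fun_prop))

lemma measurable_sharedStages_comp {Ω : Type*} [MeasurableSpace Ω] {f g : Ω → ℕ → α}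
    (hf : Measurable f) (hg : Measurable g) : Measurable fun ω => sharedStages (f ω) (g ω) :=
  (measurable_sharedStages.comp (hg.prodMk hf) :)

lemma measurable_followCost {n : ℕ} (j : Fin n) :
    Measurable fun x : Fin n → ℕ → α => followCost x j := by
  have hpair : ∀ i, Measurable fun x : Fin n → ℕ → α => sharedStages (x i) (x j) := fun i =>
    measurable_sharedStages_comp (measurable_pi_apply i) (measurable_pi_apply j)
  exact (Finset.measurable_fun_sum _ fun i _ => hpair i).add (measurable_finset_sup _ hpair)

lemma measurable_streamCost (n : ℕ) : Measurable (streamCost (α := α) n) := by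
  have hpair : ∀ i, Measurable fun q : (ℕ → α) × (ℕ → ℕ → α) => sharedStages (q.2 i) q.1 :=
    fun i => measurable_sharedStages_comp (by fun_prop) measurable_fst
  exact (Finset.measurable_fun_sum _ fun i _ => hpair i).add (measurable_finset_sup _ hpair)

variable {κ : Measure (ℕ → α)}

lemma measurable_pathCost [SFinite κ] : Measurable (pathCost κ) :=
  (measurable_from_top.comp measurable_sharedStages).stronglyMeasurable.integral_prod_right'
    |>.measurable

lemma pathCost_eq_tsum [IsFiniteMeasure κ] [NullSingletonClass κ] (y : ℕ → α) :
    pathCost κ y = ∑' k, κ.real (PiNat.cylinder y k) := by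
  have hmeas : Measurable fun x => sharedStages x y :=
    measurable_sharedStages_comp measurable_id measurable_const
  rw [pathCost, integral_eq_lintegral_of_nonneg_ae (Eventually.of_forall fun _ => by positivity)
    (by fun_prop)]
  simp only [ENNReal.ofReal_natCast]
  rw [lintegral_natCast_eq_tsum κ hmeas, ENNReal.tsum_toReal_eq fun _ => measure_ne_top _ _]
  exact tsum_congr fun k => by rw [measure_lt_sharedStages, measureReal_def]

end CommonLaw

section GeometricCylinders

variable {α : Type*} [MeasurableSpace α] {κ : Measure (ℕ → α)} [IsProbabilityMeasure κ]

lemma HasGeometricCylinders.measure_le_sharedStages (hκ : HasGeometricCylinders κ) :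
    ∃ C ρ : NNReal, ρ < 1 ∧ ∀ y k, κ {x | k ≤ sharedStages x y} ≤ C * ρ ^ k := by
  have := hκ.nullSingletonClass
  obtain ⟨C, ρ, hρ, hcyl⟩ := hκ
  refine ⟨1 + 2 * C, max ρ 2⁻¹, max_lt hρ (by norm_num), fun y k => ?_⟩
  rcases k with _ | k
  · exact prob_le_one.trans (by simp)
  · have hle : C * ρ ^ k ≤ (1 + 2 * C) * max ρ 2⁻¹ ^ (k + 1) :=
      calc C * ρ ^ k = 2 * C * (ρ ^ k * 2⁻¹) := by ring
        _ ≤ (1 + 2 * C) * (max ρ 2⁻¹ ^ k * max ρ 2⁻¹) := by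
          gcongr
          exacts [le_add_self, le_max_left _ _, le_max_right _ _]
        _ = (1 + 2 * C) * max ρ 2⁻¹ ^ (k + 1) := by rw [pow_succ]
    simp only [Nat.succ_le_iff, measure_lt_sharedStages]
    exact (hcyl y k).trans (by exact_mod_cast hle)

variable [Countable α] [DiscreteMeasurableSpace α]

lemma HasGeometricCylinders.integrable_sharedStages_pow_left (hκ : HasGeometricCylinders κ)
    (y : ℕ → α) (m : ℕ) : Integrable (fun x => (sharedStages x y : ℝ) ^ m) κ := by
  obtain ⟨C, ρ, hρ, htail⟩ := hκ.measure_le_sharedStages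
  exact integrable_pow_of_geometric_tail
    (measurable_sharedStages_comp measurable_id measurable_const) hρ (htail y) m

lemma HasGeometricCylinders.integrable_sharedStages_pow (hκ : HasGeometricCylinders κ) (m : ℕ) :
    Integrable (fun q : (ℕ → α) × (ℕ → α) => (sharedStages q.2 q.1 : ℝ) ^ m) (κ.prod κ) := by
  obtain ⟨C, ρ, hρ, htail⟩ := hκ.measure_le_sharedStages
  refine integrable_pow_of_geometric_tail measurable_sharedStages (C := C) hρ (fun k => ?_) m
  rw [Measure.prod_apply (measurableSet_le measurable_const measurable_sharedStages)]
  exact (lintegral_mono fun y => htail y k).trans (by simp)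

lemma HasGeometricCylinders.exists_pathCost_le (hκ : HasGeometricCylinders κ) :
    ∃ B, ∀ y, pathCost κ y ≤ B := by
  have := hκ.nullSingletonClass
  obtain ⟨C, ρ, hρ, hcyl⟩ := id hκ
  refine ⟨∑' k, (C : ℝ) * ρ ^ k, fun y => ?_⟩
  rw [pathCost_eq_tsum]
  exact (hκ.summable_cylinder y).tsum_le_tsum
    (fun k => ENNReal.toReal_mono (by finiteness) (hcyl y k))
    ((summable_geometric_of_lt_one ρ.2 hρ).mul_left (C : ℝ))

lemma HasGeometricCylinders.integrable_pathCost_pow (hκ : HasGeometricCylinders κ) (m : ℕ) :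
    Integrable (fun y => pathCost κ y ^ m) κ := by
  obtain ⟨B, hB⟩ := hκ.exists_pathCost_le
  refine .of_bound (measurable_pathCost.pow_const m).aestronglyMeasurable (B ^ m)
    (Eventually.of_forall fun y => ?_)
  have hpos : 0 ≤ pathCost κ y := integral_nonneg fun _ => by positivity
  rw [Real.norm_of_nonneg (pow_nonneg hpos m)]
  exact pow_le_pow_left₀ hpos (hB y) m

lemma ae_tendsto_streamCost_div (hκ : HasGeometricCylinders κ) :
    ∀ᵐ q ∂streamLaw κ,
      Tendsto (fun n : ℕ => (streamCost n q : ℝ) / (n + 1 : ℕ)) atTop (𝓝 (pathCost κ q.1)) := by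
  have hmeas : MeasurableSet {q : (ℕ → α) × (ℕ → ℕ → α) |
      Tendsto (fun n : ℕ => (streamCost n q : ℝ) / (n + 1 : ℕ)) atTop (𝓝 (pathCost κ q.1))} :=
    measurableSet_tendsto_fun
      (fun n => (measurable_from_top.comp (measurable_streamCost n)).div_const _)
      (measurable_pathCost.comp measurable_fst)
  refine (Measure.ae_prod_iff_ae_ae hmeas).mpr (Eventually.of_forall fun y => ?_)
  have hshared : Measurable fun x => (sharedStages x y : ℝ) :=
    measurable_from_top.comp (measurable_sharedStages_comp measurable_id measurable_const)
  filter_upwards [ae_tendsto_average_infinitePi κ hshared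
      (by simpa using hκ.integrable_sharedStages_pow_left y 1),
    ae_tendsto_average_infinitePi κ (hshared.pow_const 2)
      (hκ.integrable_sharedStages_pow_left y 2)] with x hmean hsq
  have hlim := (hmean.add (tendsto_sup_div_of_tendsto_average_sq hsq)).mul
    (tendsto_natCast_div_add_atTop (1 : ℝ))
  rw [add_zero, mul_one] at hlim
  refine hlim.congr fun n => ?_
  rcases eq_or_ne n 0 with rfl | hn
  · simp [streamCost]
  · simp only [streamCost, Nat.cast_add, Nat.cast_sum, Nat.cast_one]
    field_simp

/-- The maximum is at most the sum, so a cost is at most twice the sum; its powers are bounded by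
averages of identically distributed variables. -/
lemma uniformIntegrable_streamCost_div_pow (hκ : HasGeometricCylinders κ) (m : ℕ) :
    UniformIntegrable (fun (n : ℕ) q => ((streamCost n q : ℝ) / (n + 1 : ℕ)) ^ m) 1
      (streamLaw κ) := by
  set f : (ℕ → α) × (ℕ → α) → ℝ := fun q => (2 * sharedStages q.2 q.1 : ℝ) ^ m
  have hf : Measurable f :=
    ((measurable_from_top.comp measurable_sharedStages).const_mul 2).pow_const m
  have hint : Integrable f (κ.prod κ) := by
    simpa only [f, mul_pow] using (hκ.integrable_sharedStages_pow m).const_mul (2 ^ m)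
  have hident : ∀ i, IdentDistrib (fun q : (ℕ → α) × (ℕ → ℕ → α) => f (q.1, q.2 i)) f
      (streamLaw κ) (κ.prod κ) := fun i =>
    identDistrib_comp_of_measurePreserving (measurePreserving_streamLaw_eval κ i) hf
  have hUI : UniformIntegrable (fun (i : ℕ) (q : (ℕ → α) × (ℕ → ℕ → α)) => f (q.1, q.2 i)) 1
      (streamLaw κ) :=
    MemLp.uniformIntegrable_of_identDistrib le_rfl ENNReal.one_ne_top
      (memLp_one_iff_integrable.mpr ((hident 0).integrable_iff.mpr hint))
      fun i => (hident i).trans (hident 0).symm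
  refine uniformIntegrable_of_norm_le (uniformIntegrable_average_real le_rfl hUI)
    (fun n => (((measurable_from_top.comp (measurable_streamCost n)).div_const _).pow_const
      m).aestronglyMeasurable) fun n => ⟨n + 1, fun q => ?_⟩
  have hle : (streamCost n q : ℝ) ≤
      ∑ i ∈ Finset.range (n + 1), 2 * (sharedStages (q.2 i) q.1 : ℝ) :=
    mod_cast (streamCost_le n q).trans
      (Finset.sum_le_sum_of_subset (Finset.range_subset_range.mpr n.le_succ))
  calc ‖((streamCost n q : ℝ) / (n + 1 : ℕ)) ^ m‖
      = ((streamCost n q : ℝ) / (n + 1 : ℕ)) ^ m := Real.norm_of_nonneg (by positivity)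
    _ ≤ ((∑ i ∈ Finset.range (n + 1), 2 * (sharedStages (q.2 i) q.1 : ℝ)) / (n + 1 : ℕ)) ^ m := by
      gcongr
    _ ≤ (∑ i ∈ Finset.range (n + 1), f (q.1, q.2 i)) / (n + 1 : ℕ) :=
      average_pow_le _ (fun i => by positivity) n m
    _ ≤ _ := by
      simpa only [Pi.div_apply, Finset.sum_apply, Pi.natCast_apply] using Real.le_norm_self _

end GeometricCylinders

section Exchangeability

lemma measurePreserving_pi_comp {β ι ι' : Type*} [MeasurableSpace β] (κ : Measure β)
    [IsProbabilityMeasure κ] {σ : ι → ι'} (hσ : Function.Injective σ) :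
    MeasurePreserving (fun x : ι' → β => x ∘ σ) (Measure.infinitePi fun _ : ι' => κ)
      (Measure.infinitePi fun _ : ι => κ) :=
  ⟨by fun_prop, Measure.map_infinitePi_infinitePi_of_inj (P := fun _ => κ) hσ⟩

variable {α : Type*} {n : ℕ}

/-- The followed string `q.1`, numbered `0`, and the first `n` strings of the sequence `q.2`. -/
def firstStrings (n : ℕ) (q : (ℕ → α) × (ℕ → ℕ → α)) : Fin (n + 1) → ℕ → α :=
  Fin.cons q.1 (q.2 ∘ Fin.val)

lemma followCost_firstStrings (q : (ℕ → α) × (ℕ → ℕ → α)) :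
    followCost (firstStrings n q) 0 = streamCost n q := by
  have herase : Finset.univ.erase (0 : Fin (n + 1)) = Finset.univ.map (Fin.succEmb n) := by
    ext i
    simpa [eq_comm] using (Fin.exists_succ_eq (x := i)).symm
  have hrange : Finset.range n = (Finset.univ : Finset (Fin n)).map Fin.valEmbedding := by
    ext i
    simp
  simp only [followCost, streamCost, firstStrings, herase, hrange, Finset.sum_map, Finset.sup_map,
    Fin.coe_succEmb, Fin.cons_succ, Fin.cons_zero, Fin.valEmbedding_apply, Function.comp_def]

variable [MeasurableSpace α]

lemma measurePreserving_firstStrings (κ : Measure (ℕ → α)) [IsProbabilityMeasure κ] (n : ℕ) :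
    MeasurePreserving (firstStrings n) (streamLaw κ) (Measure.pi fun _ => κ) := by
  have hval := measurePreserving_pi_comp κ (Fin.val_injective (n := n))
  rw [Measure.infinitePi_eq_pi (ι := Fin n)] at hval
  have hcons : firstStrings n =
      (MeasurableEquiv.piFinSuccAbove (fun _ : Fin (n + 1) => ℕ → α) 0).symm ∘
        Prod.map id fun x => x ∘ Fin.val := by
    ext q : 1
    exact (Fin.insertNth_zero' _ _).symm
  rw [hcons]
  exact (measurePreserving_piFinSuccAbove (fun _ : Fin (n + 1) => κ) 0).symm.comp
    ((MeasurePreserving.id κ).prod hval)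

variable [Countable α] [DiscreteMeasurableSpace α]

lemma identDistrib_followCost (κ : Measure (ℕ → α)) [IsProbabilityMeasure κ] (i j : Fin n) :
    IdentDistrib (fun x : Fin n → ℕ → α => followCost x i) (fun x => followCost x j)
      (Measure.pi fun _ => κ) (Measure.pi fun _ => κ) := by
  have hswap := measurePreserving_pi_comp κ (Equiv.swap i j).injective
  rw [Measure.infinitePi_eq_pi] at hswap
  simpa only [Function.comp_def (fun x : Fin n → ℕ → α => followCost x j), followCost_comp_perm,
    Equiv.swap_apply_right] using
    identDistrib_comp_of_measurePreserving hswap (measurable_followCost j)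

lemma identDistrib_followCost_streamCost (κ : Measure (ℕ → α)) [IsProbabilityMeasure κ]
    (j : Fin (n + 1)) :
    IdentDistrib (fun x : Fin (n + 1) → ℕ → α => followCost x j) (streamCost n)
      (Measure.pi fun _ => κ) (streamLaw κ) := by
  refine (identDistrib_followCost κ j 0).trans (IdentDistrib.symm ?_)
  simpa only [Function.comp_def, followCost_firstStrings] using
    identDistrib_comp_of_measurePreserving (measurePreserving_firstStrings κ n)
      (measurable_followCost 0)

end Exchangeability

section UniformRank

lemma ae_ne_of_indepFun {Ω β : Type*} [MeasurableSpace Ω] [MeasurableSpace β] [MeasurableEq β]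
    {P : Measure Ω} [IsFiniteMeasure P] {f g : Ω → β} (hf : Measurable f) (hg : Measurable g)
    (hfg : IndepFun f g P) [NullSingletonClass (P.map g)] : ∀ᵐ ω ∂P, f ω ≠ g ω := by
  have hprod := (indepFun_iff_map_prod_eq_prod_map_map hf.aemeasurable hg.aemeasurable).mp hfg
  have hne : ∀ᵐ q ∂P.map (fun ω => (f ω, g ω)), q.1 ≠ q.2 := by
    rw [hprod]
    exact (Measure.ae_prod_iff_ae_ae (p := fun q => q.1 ≠ q.2)
      (measurableSet_eq_fun measurable_fst measurable_snd).compl).mpr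
      (Eventually.of_forall fun b => (Measure.ae_ne _ b).mono fun _ => Ne.symm)
  exact ae_of_ae_map (hf.prodMk hg).aemeasurable hne

lemma ae_injective_pi {ι β : Type*} [Fintype ι] [MeasurableSpace β] [MeasurableEq β]
    (κ : Measure β) [IsProbabilityMeasure κ] [NullSingletonClass κ] :
    ∀ᵐ x ∂Measure.pi fun _ : ι => κ, Function.Injective x := by
  have hne : ∀ i j, i ≠ j → ∀ᵐ x ∂Measure.pi fun _ : ι => κ, x i ≠ x j := fun i j hij => by
    have : NullSingletonClass ((Measure.pi fun _ : ι => κ).map fun x => x j) := by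
      rwa [(measurePreserving_eval (fun _ : ι => κ) j).map_eq]
    exact ae_ne_of_indepFun (measurable_pi_apply i) (measurable_pi_apply j)
      ((iIndepFun_pi (X := fun _ => id) fun _ => aemeasurable_id).indepFun hij)
  simp only [← ae_all_iff] at hne
  filter_upwards [hne] with x hx i j hij
  by_contra h
  exact hx i j h hij

variable {n : ℕ}

lemma measurableSet_state_mem (k : ℕ) (S : Set (Finset (Fin n) × ℕ)) :
    MeasurableSet {q : (Fin n → ℕ → Fin 2) × ℕ | state q.1 q.2 k ∈ S} := by
  induction k generalizing S with
  | zero =>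
    exact measurable_snd
      (MeasurableSet.of_discrete (s := {ℓ : ℕ | ((Finset.univ : Finset (Fin n)), ℓ) ∈ S}))
  | succ k ih =>
    have hsucc : {q : (Fin n → ℕ → Fin 2) × ℕ | state q.1 q.2 (k + 1) ∈ S} =
        ⋃ s, {q | state q.1 q.2 k ∈ ({s} : Set (Finset (Fin n) × ℕ))} ∩
          {q | step q.1 k s ∈ S} := by
      ext q
      simp [state]
    rw [hsucc]
    refine MeasurableSet.iUnion fun s => (ih _).inter ?_
    have hdigit : Measurable fun (q : (Fin n → ℕ → Fin 2) × ℕ) i => q.1 i k := by fun_prop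
    exact hdigit (MeasurableSet.of_discrete
      (s := {c : Fin n → Fin 2 | step (fun i _ => c i) k s ∈ S}))

lemma measurable_bucketOps :
    Measurable fun q : (Fin n → ℕ → Fin 2) × ℕ => bucketOps q.1 q.2 :=
  Measurable.tsum fun k t _ =>
    measurableSet_state_mem k {s | (if 2 ≤ s.1.card then (s.1.card : ℝ≥0∞) else 0) ∈ t}

/-- The uniform distribution on the ranks `1, …, n`. -/
def rankLaw (n : ℕ) : Measure ℕ := (n : ℝ≥0∞)⁻¹ • ∑ ℓ ∈ Finset.Icc 1 n, Measure.dirac ℓ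

variable {μ : Fin 2 → ℝ} {p : Matrix (Fin 2) (Fin 2) ℝ} {Ω : Type*} [MeasurableSpace Ω]
  {P : Measure Ω} [IsProbabilityMeasure P] {X : Fin (n + 1) → Ω → ℕ → Fin 2} {R : Ω → ℕ}

lemma IsUniformRankModel.map_rank (h : IsUniformRankModel P μ p (n + 1) X R) :
    P.map R = rankLaw (n + 1) := by
  have := Measure.isProbabilityMeasure_map (μ := P) h.measurable_rank.aemeasurable
  have hmem : ∀ ℓ ∈ Finset.Icc 1 (n + 1), P.map R {ℓ} = ((n + 1 : ℕ) : ℝ≥0∞)⁻¹ := fun ℓ hℓ => by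
    rw [Measure.map_apply h.measurable_rank (measurableSet_singleton ℓ), ← h.uniform_rank ℓ hℓ]
    rfl
  have hone : P.map R (Finset.Icc 1 (n + 1) : Finset ℕ) = 1 := by
    rw [← sum_measure_singleton, Finset.sum_congr rfl hmem]
    simp only [Finset.sum_const, Nat.card_Icc, Nat.add_sub_cancel, nsmul_eq_mul]
    exact ENNReal.mul_inv_cancel (by simp) (ENNReal.natCast_ne_top _)
  refine Measure.ext_of_singleton fun ℓ => ?_
  by_cases hℓ : ℓ ∈ Finset.Icc 1 (n + 1)
  · simp [hmem ℓ hℓ, rankLaw, Set.indicator_apply, Finset.sum_ite_eq', hℓ]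
  · have hzero : P.map R {ℓ} = 0 :=
      measure_mono_null (Set.singleton_subset_iff.mpr (by simpa using hℓ))
        ((prob_compl_eq_zero_iff MeasurableSet.of_discrete).mpr hone)
    simp [hzero, rankLaw, Set.indicator_apply, hℓ]

/-- The ranks almost surely enumerate the strings, which are exchangeable. -/
lemma lintegral_bucketOps (κ : Measure (ℕ → Fin 2)) [IsProbabilityMeasure κ] [NullSingletonClass κ]
    {F : ℝ≥0∞ → ℝ≥0∞} (hF : Measurable F) (j : Fin n) :
    ∫⁻ q, F (bucketOps q.1 q.2) ∂(Measure.pi fun _ : Fin n => κ).prod (rankLaw n) =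
      ∫⁻ x, F (followCost x j) ∂Measure.pi fun _ : Fin n => κ := by
  have hFb : Measurable fun q : (Fin n → ℕ → Fin 2) × ℕ => F (bucketOps q.1 q.2) :=
    hF.comp measurable_bucketOps
  have hFc : ∀ i, Measurable fun x : Fin n → ℕ → Fin 2 => F (followCost x i) := fun i =>
    hF.comp (measurable_from_top.comp (measurable_followCost i))
  have hsame : ∀ i, ∫⁻ x, F (followCost x i) ∂Measure.pi (fun _ : Fin n => κ) =
      ∫⁻ x, F (followCost x j) ∂Measure.pi fun _ : Fin n => κ := fun i =>
    ((identDistrib_followCost κ i j).comp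
      (hF.comp measurable_from_top : Measurable fun m : ℕ => F m)).lintegral_eq
  calc ∫⁻ q, F (bucketOps q.1 q.2) ∂(Measure.pi fun _ : Fin n => κ).prod (rankLaw n)
      = ∫⁻ x, (n : ℝ≥0∞)⁻¹ * ∑ ℓ ∈ Finset.Icc 1 n, F (bucketOps x ℓ)
          ∂Measure.pi fun _ : Fin n => κ := by
        rw [lintegral_prod _ hFb.aemeasurable]
        simp [rankLaw]
    _ = ∫⁻ x, (n : ℝ≥0∞)⁻¹ * ∑ i, F (followCost x i) ∂Measure.pi fun _ : Fin n => κ :=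
        lintegral_congr_ae ((ae_injective_pi κ).mono fun x hx => by
          simp only [sum_bucketOps hx])
    _ = (n : ℝ≥0∞)⁻¹ * ∑ i, ∫⁻ x, F (followCost x i) ∂Measure.pi fun _ : Fin n => κ := by
        rw [lintegral_const_mul _ (Finset.measurable_fun_sum _ fun i _ => hFc i),
          lintegral_finsetSum _ fun i _ => hFc i]
    _ = ∫⁻ x, F (followCost x j) ∂Measure.pi fun _ : Fin n => κ := by
        rw [Finset.sum_congr rfl fun i _ => hsame i, Finset.sum_const, Finset.card_univ,
          Fintype.card_fin, nsmul_eq_mul, ← mul_assoc, ENNReal.inv_mul_cancel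
          (by exact_mod_cast j.pos.ne') (ENNReal.natCast_ne_top n), one_mul]

lemma IsUniformRankModel.identDistrib_bucketOps (h : IsUniformRankModel P μ p (n + 1) X R)
    {κ : Measure (ℕ → Fin 2)} [IsProbabilityMeasure κ] [NullSingletonClass κ]
    (hκ : ∀ i, P.map (X i) = κ) :
    IdentDistrib (fun ω => bucketOps (fun i => X i ω) (R ω))
      (fun q => (streamCost n q : ℝ≥0∞)) P (streamLaw κ) := by
  have hdata : Measurable fun ω i => X i ω := measurable_pi_iff.mpr h.measurable_data
  have hlaw : MeasurePreserving (fun ω => ((fun i => X i ω), R ω)) P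
      ((Measure.pi fun _ => κ).prod (rankLaw (n + 1))) := by
    refine ⟨hdata.prodMk h.measurable_rank, ?_⟩
    rw [(indepFun_iff_map_prod_eq_prod_map_map hdata.aemeasurable
      h.measurable_rank.aemeasurable).mp h.indep_rank, h.map_rank,
      (iIndepFun_iff_map_fun_eq_pi_map fun i => (h.measurable_data i).aemeasurable).mp h.indep_data]
    simp only [hκ]
  refine (identDistrib_comp_of_measurePreserving hlaw measurable_bucketOps).trans
    (IdentDistrib.trans ?_ ((identDistrib_followCost_streamCost κ 0).comp
      (measurable_from_top : Measurable fun m : ℕ => (m : ℝ≥0∞))))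
  have hcost : Measurable fun x : Fin (n + 1) → ℕ → Fin 2 => (followCost x 0 : ℝ≥0∞) :=
    measurable_from_top.comp (measurable_followCost 0)
  refine ⟨measurable_bucketOps.aemeasurable, hcost.aemeasurable,
    Measure.ext_of_lintegral _ fun F hF => ?_⟩
  rw [lintegral_map hF measurable_bucketOps, lintegral_bucketOps κ hF 0]
  exact (lintegral_map hF hcost).symm

end UniformRank

/-! ### Markov sources -/

section Strings

variable {α : Type*}

/-- The string `y` without its first digit. -/
def shift (y : ℕ → α) : ℕ → α := fun m => y (m + 1)

/-- The string `y` with the digit `a` put in front. -/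
def cons (a : α) (y : ℕ → α) : ℕ → α
  | 0 => a
  | m + 1 => y m

@[simp] lemma cons_zero (a : α) (y : ℕ → α) : cons a y 0 = a := rfl

@[simp] lemma shift_cons (a : α) (y : ℕ → α) : shift (cons a y) = y := rfl

lemma mem_cylinder_succ {x y : ℕ → α} {k : ℕ} :
    x ∈ PiNat.cylinder y (k + 1) ↔ x 0 = y 0 ∧ shift x ∈ PiNat.cylinder (shift y) k := by
  rw [PiNat.mem_cylinder_iff, PiNat.mem_cylinder_iff, Nat.forall_lt_succ_left]
  rfl

lemma mem_cylinder_cons_succ {x y : ℕ → α} {a : α} {k : ℕ} :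
    x ∈ PiNat.cylinder (cons a y) (k + 1) ↔ x 0 = a ∧ shift x ∈ PiNat.cylinder y k :=
  mem_cylinder_succ

lemma isPiSystem_cylinders :
    IsPiSystem {s : Set (ℕ → α) | ∃ (x : ℕ → α) (n : ℕ), s = PiNat.cylinder x n} := by
  have inter_eq : ∀ {x y : ℕ → α} {m n : ℕ}, m ≤ n →
      (PiNat.cylinder x m ∩ PiNat.cylinder y n).Nonempty →
      PiNat.cylinder x m ∩ PiNat.cylinder y n = PiNat.cylinder y n := by
    rintro x y m n hmn ⟨z, hzx, hzy⟩
    rw [PiNat.mem_cylinder_iff_eq] at hzx hzy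
    rw [Set.inter_eq_right, ← hzx, ← hzy]
    exact PiNat.cylinder_anti z hmn
  rintro _ ⟨x, m, rfl⟩ _ ⟨y, n, rfl⟩ hne
  rcases le_total m n with hmn | hnm
  · exact ⟨y, n, inter_eq hmn hne⟩
  · rw [Set.inter_comm] at hne ⊢
    exact ⟨x, m, inter_eq hnm hne⟩

variable [MeasurableSpace α]

lemma measurable_shift : Measurable (shift (α := α)) :=
  measurable_pi_iff.mpr fun m => measurable_pi_apply (m + 1)

lemma measurable_cons (a : α) : Measurable (cons a) :=
  measurable_pi_iff.mpr fun m => by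
    cases m with
    | zero => exact measurable_const
    | succ m => exact measurable_pi_apply m

lemma measurableSet_cylinder [MeasurableSingletonClass α] (y : ℕ → α) (k : ℕ) :
    MeasurableSet (PiNat.cylinder y k) := by
  rw [PiNat.cylinder_eq_pi]
  exact MeasurableSet.pi (Finset.countable_toSet _) fun _ _ => measurableSet_singleton _

lemma generateFrom_cylinders [Countable α] [DiscreteMeasurableSpace α] :
    (inferInstance : MeasurableSpace (ℕ → α)) =
      MeasurableSpace.generateFrom {s | ∃ (x : ℕ → α) (n : ℕ), s = PiNat.cylinder x n} := by
  let _ : TopologicalSpace α := ⊥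
  have : DiscreteTopology α := ⟨rfl⟩
  rw [← (PiNat.isTopologicalBasis_cylinders fun _ => α).borel_eq_generateFrom]
  exact BorelSpace.measurable_eq

end Strings

section PrefixProb

variable {α : Type*} {p : Matrix α α ℝ} {μ : α → ℝ} {ρ : ℝ}

/-- The probability that a Markov source with initial distribution `μ` and transition matrix `p`
produces the first `k` digits of `y`. -/
def prefixProb (p : Matrix α α ℝ) : (α → ℝ) → (ℕ → α) → ℕ → ℝ
  | _, _, 0 => 1
  | μ, y, k + 1 => μ (y 0) * prefixProb p (p (y 0)) (shift y) k

lemma prefixProb_zero (y : ℕ → α) : prefixProb p μ y 0 = 1 := rfl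

lemma prefixProb_succ (y : ℕ → α) (k : ℕ) :
    prefixProb p μ y (k + 1) = μ (y 0) * prefixProb p (p (y 0)) (shift y) k := rfl

lemma prefixProb_cons_succ (a : α) (y : ℕ → α) (k : ℕ) :
    prefixProb p μ (cons a y) (k + 1) = μ a * prefixProb p (p a) y k := rfl

lemma prefixProb_succ_eq_prod (y : ℕ → α) (k : ℕ) :
    prefixProb p μ y (k + 1) = μ (y 0) * ∏ j ∈ Finset.range k, p (y j) (y (j + 1)) := by
  induction k generalizing μ y with
  | zero => rfl
  | succ k ih =>
    rw [prefixProb_succ, ih, Finset.prod_range_succ', mul_comm (∏ _ ∈ _, _)]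
    rfl

lemma prefixProb_nonneg (hμ : ∀ a, 0 ≤ μ a) (hp : ∀ a b, 0 ≤ p a b) (y : ℕ → α) (k : ℕ) :
    0 ≤ prefixProb p μ y k := by
  induction k generalizing μ y with
  | zero => exact zero_le_one
  | succ k ih => exact mul_nonneg (hμ _) (ih (hp _) _)

lemma prefixProb_row_le (hp : ∀ a b, 0 ≤ p a b) (hρ : ∀ a b, p a b ≤ ρ) (a : α) (y : ℕ → α)
    (k : ℕ) : prefixProb p (p a) y k ≤ ρ ^ k := by
  induction k generalizing a y with
  | zero => rw [prefixProb_zero, pow_zero]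
  | succ k ih =>
    rw [prefixProb_succ, pow_succ']
    exact mul_le_mul (hρ _ _) (ih _ _) (prefixProb_nonneg (hp _) hp _ _)
      ((hp a a).trans (hρ a a))

lemma prefixProb_succ_le (hμ : ∀ a, μ a ≤ 1) (hp : ∀ a b, 0 ≤ p a b) (hρ : ∀ a b, p a b ≤ ρ)
    (y : ℕ → α) (k : ℕ) : prefixProb p μ y (k + 1) ≤ ρ ^ k := by
  rw [prefixProb_succ, ← one_mul (ρ ^ k)]
  exact mul_le_mul (hμ _) (prefixProb_row_le hp hρ _ _ _) (prefixProb_nonneg (hp _) hp _ _)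
    zero_le_one

lemma exists_entries_le [Finite α] (hlt : ∀ a b, p a b < 1) :
    ∃ ρ ∈ Set.Ioo (0 : ℝ) 1, ∀ a b, p a b ≤ ρ :=
  (Eventually.and (Ioo_mem_nhdsLT one_pos) <| eventually_all.mpr fun a =>
    eventually_all.mpr fun b => mem_of_superset (Ioo_mem_nhdsLT (hlt a b))
      fun _ hx => hx.1.le).exists

end PrefixProb

section ChainLaw

variable {α : Type*} [MeasurableSpace α] {p : Matrix α α ℝ} {μ : α → ℝ} {κ κ' : Measure (ℕ → α)}

/-- `κ` is the law of a string produced by the Markov source with initial distribution `μ` and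
transition matrix `p`. -/
def IsChainLaw (p : Matrix α α ℝ) (μ : α → ℝ) (κ : Measure (ℕ → α)) : Prop :=
  ∀ y k, κ (PiNat.cylinder y k) = ENNReal.ofReal (prefixProb p μ y k)

lemma IsMarkovChain.isChainLaw {p : Matrix (Fin 2) (Fin 2) ℝ} {μ : Fin 2 → ℝ} {Ω : Type*}
    [MeasurableSpace Ω] {P : Measure Ω} [IsProbabilityMeasure P] {X : Ω → ℕ → Fin 2}
    (h : IsMarkovChain P μ p X) (hX : Measurable X) : IsChainLaw p μ (P.map X) := by
  intro y k
  rw [Measure.map_apply hX (measurableSet_cylinder y k)]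
  cases k with
  | zero => simp [prefixProb_zero]
  | succ k =>
    rw [prefixProb_succ_eq_prod, ← h k y]
    simp only [Set.preimage, PiNat.mem_cylinder_iff, Nat.lt_succ_iff]

lemma IsChainLaw.isProbabilityMeasure [Nonempty α] (h : IsChainLaw p μ κ) :
    IsProbabilityMeasure κ := by
  inhabit α
  simpa [prefixProb_zero, isProbabilityMeasure_iff] using h default 0

lemma IsChainLaw.real_cylinder (h : IsChainLaw p μ κ) (hμ : ∀ a, 0 ≤ μ a)
    (hp : ∀ a b, 0 ≤ p a b) (y : ℕ → α) (k : ℕ) :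
    κ.real (PiNat.cylinder y k) = prefixProb p μ y k := by
  rw [measureReal_def, h, ENNReal.toReal_ofReal (prefixProb_nonneg hμ hp y k)]

lemma IsChainLaw.unique [Countable α] [DiscreteMeasurableSpace α]
    (h : IsChainLaw p μ κ) (h' : IsChainLaw p μ κ') : κ = κ' := by
  cases isEmpty_or_nonempty α
  · exact Subsingleton.elim κ κ'
  have := h.isProbabilityMeasure
  have := h'.isProbabilityMeasure
  refine ext_of_generate_finite _ generateFrom_cylinders isPiSystem_cylinders ?_ (by simp)
  rintro _ ⟨x, n, rfl⟩
  rw [h, h']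

lemma IsChainLaw.hasGeometricCylinders [Finite α] (h : IsChainLaw p μ κ) (hμ : ∀ a, μ a ≤ 1)
    (hp : ∀ a b, 0 ≤ p a b) (hlt : ∀ a b, p a b < 1) : HasGeometricCylinders κ := by
  obtain ⟨ρ, ⟨hρ0, hρ1⟩, hρ⟩ := exists_entries_le hlt
  lift ρ to NNReal using hρ0.le
  refine ⟨ρ⁻¹, ρ, mod_cast hρ1, fun y k => ?_⟩
  rw [h y k]
  have hle : prefixProb p μ y k ≤ (ρ⁻¹ * ρ ^ k : NNReal) := by
    push_cast
    cases k with
    | zero => simpa [prefixProb_zero] using (one_le_inv₀ hρ0).mpr hρ1.le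
    | succ k =>
      rw [pow_succ', inv_mul_cancel_left₀ hρ0.ne']
      exact prefixProb_succ_le hμ hp hρ y k
  exact_mod_cast ENNReal.ofReal_le_coe.mpr hle

end ChainLaw

section FirstStep

variable {α : Type*} [Fintype α] [MeasurableSpace α] [DiscreteMeasurableSpace α]
  {p : Matrix α α ℝ} {μ : α → ℝ} {κ : Measure (ℕ → α)}

/-- The rows of `p` are the initial distributions of the strings that remain after the first digit;
their laws arise from `κ` by conditioning on the second digit and dropping the first two. -/
lemma IsChainLaw.exists_row (h : IsChainLaw p μ κ) (hμ : ∀ a, 0 ≤ μ a) (hp : ∀ a b, 0 ≤ p a b)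
    (b : α) (hpos : 0 < ∑ a, μ a * p a b) : ∃ κ' : Measure (ℕ → α), IsChainLaw p (p b) κ' := by
  have hdrop : Measurable fun x : ℕ → α => shift (shift x) :=
    measurable_shift.comp measurable_shift
  refine ⟨(ENNReal.ofReal (∑ a, μ a * p a b))⁻¹ •
    (κ.restrict {x | x 1 = b}).map (fun x => shift (shift x)), fun y k => ?_⟩
  have hset : (fun x => shift (shift x)) ⁻¹' PiNat.cylinder y k ∩ {x : ℕ → α | x 1 = b} =
      ⋃ a, PiNat.cylinder (cons a (cons b y)) (k + 2) := by
    ext x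
    have hx : shift x 0 = x 1 := rfl
    simp only [Set.mem_inter_iff, Set.mem_preimage, Set.mem_ofPred_eq, Set.mem_iUnion,
      mem_cylinder_cons_succ, hx, exists_eq_left']
    exact and_comm
  have hdisj : Pairwise (Function.onFun Disjoint
      fun a => PiNat.cylinder (cons a (cons b y)) (k + 2)) := fun a a' hne =>
    Set.disjoint_left.mpr fun x hx hx' =>
      hne ((mem_cylinder_cons_succ.mp hx).1.symm.trans (mem_cylinder_cons_succ.mp hx').1)
  rw [Measure.smul_apply, Measure.map_apply hdrop (measurableSet_cylinder y k),
    Measure.restrict_apply (hdrop (measurableSet_cylinder y k)), hset,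
    measure_iUnion hdisj fun _ => measurableSet_cylinder _ _, tsum_fintype]
  simp only [h _ _]
  rw [← ENNReal.ofReal_sum_of_nonneg fun _ _ => prefixProb_nonneg hμ hp _ _]
  simp only [prefixProb_cons_succ, ← mul_assoc]
  rw [← Finset.sum_mul, ENNReal.ofReal_mul hpos.le, smul_eq_mul, ← mul_assoc,
    ENNReal.inv_mul_cancel (by simpa using hpos) ENNReal.ofReal_ne_top, one_mul]

lemma IsChainLaw.eq_sum_map_cons (h : IsChainLaw p μ κ) (hμ : μ ∈ stdSimplex ℝ α)
    {κr : α → Measure (ℕ → α)} (hr : ∀ a, IsChainLaw p (p a) (κr a)) :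
    κ = ∑ a, ENNReal.ofReal (μ a) • (κr a).map (cons a) := by
  refine h.unique fun y k => ?_
  simp only [Measure.finsetSum_apply, Measure.smul_apply, smul_eq_mul,
    Measure.map_apply (measurable_cons _) (measurableSet_cylinder y k)]
  cases k with
  | zero =>
    have := fun a : α => have : Nonempty α := ⟨a⟩; (hr a).isProbabilityMeasure
    simp [prefixProb_zero, ← ENNReal.ofReal_sum_of_nonneg fun a _ => hμ.1 a, hμ.2]
  | succ k =>
    rw [Finset.sum_eq_single_of_mem (y 0) (Finset.mem_univ _), prefixProb_succ,
      ENNReal.ofReal_mul (hμ.1 _), ← hr]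
    · simp only [Set.preimage, mem_cylinder_succ, cons_zero, shift_cons, true_and,
        Set.ofPred_mem_eq]
    · intro a _ ha
      simp only [Set.preimage, mem_cylinder_succ, cons_zero, ha, false_and, Set.ofPred_false,
        measure_empty, mul_zero]

lemma IsChainLaw.pathCost_cons (h : IsChainLaw p μ κ) (hμ : μ ∈ stdSimplex ℝ α)
    (hp : ∀ a b, 0 ≤ p a b) (hlt : ∀ a b, p a b < 1) {a : α} {κ' : Measure (ℕ → α)}
    (h' : IsChainLaw p (p a) κ') (x : ℕ → α) :
    pathCost κ (cons a x) = μ a * pathCost κ' x + 1 := by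
  have : Nonempty α := ⟨a⟩
  have := h.isProbabilityMeasure
  have := h'.isProbabilityMeasure
  have hκ := h.hasGeometricCylinders (fun a => (mem_Icc_of_mem_stdSimplex hμ a).2) hp hlt
  have hκ' := h'.hasGeometricCylinders (fun b => (hlt a b).le) hp hlt
  have := hκ.nullSingletonClass
  have := hκ'.nullSingletonClass
  rw [pathCost_eq_tsum, pathCost_eq_tsum, (hκ.summable_cylinder _).tsum_eq_zero_add, add_comm,
    ← tsum_mul_left]
  simp only [h.real_cylinder hμ.1 hp, h'.real_cylinder (hp a) hp, prefixProb_cons_succ,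
    prefixProb_zero]

lemma IsChainLaw.map_pathCost (h : IsChainLaw p μ κ) (hμ : μ ∈ stdSimplex ℝ α)
    (hp : ∀ a b, 0 ≤ p a b) (hlt : ∀ a b, p a b < 1) {κr : α → Measure (ℕ → α)}
    (hr : ∀ a, IsChainLaw p (p a) (κr a)) :
    κ.map (pathCost κ) =
      ∑ a, ENNReal.ofReal (μ a) •
        ((κr a).map (pathCost (κr a))).map fun x => μ a * x + 1 := by
  have : Nonempty α := by
    by_contra hα
    rw [not_nonempty_iff] at hα
    simp [stdSimplex_of_isEmpty_index] at hμ
  have := h.isProbabilityMeasure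
  have := fun a => (hr a).isProbabilityMeasure
  have hcons : ∀ a, pathCost κ ∘ cons a = (fun x => μ a * x + 1) ∘ pathCost (κr a) := fun a =>
    funext (h.pathCost_cons hμ hp hlt (hr a))
  have hmeas : Measurable (pathCost κ) := measurable_pathCost
  calc κ.map (pathCost κ)
      = (∑ a, ENNReal.ofReal (μ a) • (κr a).map (cons a)).map (pathCost κ) :=
        congrArg (Measure.map (pathCost κ)) (h.eq_sum_map_cons hμ hr)
    _ = ∑ a, ENNReal.ofReal (μ a) • (κr a).map (pathCost κ ∘ cons a) := by
      simp only [Measure.map_finset_sum' hmeas.aemeasurable, Measure.map_smul,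
        Measure.map_map hmeas (measurable_cons _)]
    _ = _ := Finset.sum_congr rfl fun a _ => by
      rw [Measure.map_map (by fun_prop) measurable_pathCost, hcons]

end FirstStep

/-! ### The fixed-point system -/

section MixLaw

variable {q : ℝ} {ν₀ ν₁ ν₀' ν₁' : Measure ℝ} [IsProbabilityMeasure ν₀] [IsProbabilityMeasure ν₁]
  [IsProbabilityMeasure ν₀'] [IsProbabilityMeasure ν₁']

lemma mixLaw_eq (q : ℝ) (ν₀ ν₁ : Measure ℝ) [IsProbabilityMeasure ν₀] [IsProbabilityMeasure ν₁] :
    mixLaw q ν₀ ν₁ = ENNReal.ofReal q • ν₀.map (fun x => q * x + 1) +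
      ENNReal.ofReal (1 - q) • ν₁.map (fun x => (1 - q) * x + 1) := by
  have hmix : Measurable fun t : ℝ × ℝ × ℝ =>
      t.1 * q * t.2.1 + (1 - t.1) * (1 - q) * t.2.2 + 1 := by fun_prop
  have hfst : (ν₀.prod ν₁).map Prod.fst = ν₀ := by simp [Measure.map_fst_prod]
  have hsnd : (ν₀.prod ν₁).map Prod.snd = ν₁ := by simp [Measure.map_snd_prod]
  rw [mixLaw, bernoulliLaw, Measure.add_prod, Measure.prod_smul_left, Measure.prod_smul_left,
    Measure.dirac_prod, Measure.dirac_prod, Measure.map_add _ _ hmix, Measure.map_smul,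
    Measure.map_smul, Measure.map_map hmix (by fun_prop), Measure.map_map hmix (by fun_prop)]
  nth_rw 3 [← hfst]
  nth_rw 4 [← hsnd]
  rw [Measure.map_map (by fun_prop) measurable_fst, Measure.map_map (by fun_prop) measurable_snd]
  congr 3 <;> ext t <;> simp

lemma integral_mixLaw {E : Type*} [NormedAddCommGroup E] [NormedSpace ℝ E]
    (hq : q ∈ Set.Icc 0 1) {f : ℝ → E} (hf : StronglyMeasurable f)
    (hint₀ : Integrable (fun x => f (q * x + 1)) ν₀)
    (hint₁ : Integrable (fun x => f ((1 - q) * x + 1)) ν₁) :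
    ∫ x, f x ∂(mixLaw q ν₀ ν₁) =
      q • ∫ x, f (q * x + 1) ∂ν₀ + (1 - q) • ∫ x, f ((1 - q) * x + 1) ∂ν₁ := by
  have haff : ∀ c : ℝ, Measurable fun x : ℝ => c * x + 1 := fun c => by fun_prop
  have hmap : ∀ (c : ℝ) (ν : Measure ℝ), Integrable (fun x => f (c * x + 1)) ν →
      Integrable f (ν.map fun x => c * x + 1) := fun c ν =>
    (integrable_map_measure hf.aestronglyMeasurable (haff c).aemeasurable).mpr
  rw [mixLaw_eq, integral_add_measure ((hmap _ _ hint₀).smul_measure ENNReal.ofReal_ne_top)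
    ((hmap _ _ hint₁).smul_measure ENNReal.ofReal_ne_top), integral_smul_measure,
    integral_smul_measure, ENNReal.toReal_ofReal hq.1, ENNReal.toReal_ofReal (sub_nonneg.mpr hq.2),
    integral_map (haff _).aemeasurable hf.aestronglyMeasurable,
    integral_map (haff _).aemeasurable hf.aestronglyMeasurable]

lemma integral_id_mixLaw (hq : q ∈ Set.Icc 0 1) (hint₀ : Integrable (fun x => x) ν₀)
    (hint₁ : Integrable (fun x => x) ν₁) :
    ∫ x, x ∂(mixLaw q ν₀ ν₁) = q ^ 2 * ∫ x, x ∂ν₀ + (1 - q) ^ 2 * ∫ x, x ∂ν₁ + 1 := by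
  rw [integral_mixLaw hq (f := fun x => x) stronglyMeasurable_id
    ((hint₀.const_mul q).add (integrable_const 1))
    ((hint₁.const_mul (1 - q)).add (integrable_const 1)),
    integral_add (hint₀.const_mul q) (integrable_const 1),
    integral_add (hint₁.const_mul (1 - q)) (integrable_const 1), integral_const_mul,
    integral_const_mul]
  simp only [integral_const, probReal_univ, smul_eq_mul, mul_one]
  ring

lemma charFun_mixLaw (hq : q ∈ Set.Icc 0 1) (t : ℝ) :
    charFun (mixLaw q ν₀ ν₁) t = Complex.exp (t * Complex.I) *
      (q * charFun ν₀ (q * t) + (1 - q : ℝ) * charFun ν₁ ((1 - q) * t)) := by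
  have hexp : ∀ c x : ℝ, Complex.exp (t * ((c * x + 1 : ℝ) : ℂ) * Complex.I) =
      Complex.exp (t * Complex.I) * Complex.exp ((c * t : ℝ) * x * Complex.I) := by
    intro c x
    rw [← Complex.exp_add]
    congr 1
    push_cast
    ring
  have hint : ∀ (c : ℝ) (ν : Measure ℝ) [IsProbabilityMeasure ν],
      Integrable (fun x : ℝ => Complex.exp (t * ((c * x + 1 : ℝ) : ℂ) * Complex.I)) ν := by
    intro c ν _
    refine Integrable.of_bound (C := 1) (by fun_prop) (Eventually.of_forall fun x => ?_)
    rw [← Complex.ofReal_mul, Complex.norm_exp_ofReal_mul_I]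
  have hcont : Continuous fun x : ℝ => Complex.exp (t * x * Complex.I) := by fun_prop
  rw [charFun_apply_real, integral_mixLaw hq hcont.stronglyMeasurable (hint _ _) (hint _ _)]
  simp_rw [hexp, integral_const_mul]
  rw [charFun_apply_real, charFun_apply_real, Complex.real_smul, Complex.real_smul]
  ring

lemma norm_charFun_mixLaw_sub_le (hq : q ∈ Set.Icc 0 1) (t : ℝ) :
    ‖charFun (mixLaw q ν₀ ν₁) t - charFun (mixLaw q ν₀' ν₁') t‖ ≤
      q * ‖charFun ν₀ (q * t) - charFun ν₀' (q * t)‖ +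
        (1 - q) * ‖charFun ν₁ ((1 - q) * t) - charFun ν₁' ((1 - q) * t)‖ := by
  rw [charFun_mixLaw hq, charFun_mixLaw hq, ← mul_sub, norm_mul, Complex.norm_exp_ofReal_mul_I,
    one_mul, add_sub_add_comm, ← mul_sub, ← mul_sub]
  refine (norm_add_le _ _).trans_eq ?_
  rw [norm_mul, norm_mul, Complex.norm_real, Complex.norm_real, Real.norm_of_nonneg hq.1,
    Real.norm_of_nonneg (sub_nonneg.mpr hq.2)]

end MixLaw

lemma forall_of_eventually_of_contraction {S : ℝ → Prop} {ρ : ℝ} (hρ : ρ ∈ Set.Ioo 0 1)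
    (hnear : ∀ᶠ t in 𝓝 0, S t) (hscale : ∀ t, (∀ s, |s| ≤ ρ * |t| → S s) → S t) (t : ℝ) :
    S t := by
  obtain ⟨δ, hδ, hball⟩ := Metric.eventually_nhds_iff.mp hnear
  have hpow : ∀ (m : ℕ) (t : ℝ), ρ ^ m * |t| < δ → S t := by
    intro m
    induction m with
    | zero => exact fun t ht => hball (by simpa [Real.dist_eq] using ht)
    | succ m ih =>
      refine fun t ht => hscale t fun s hs => ih s (lt_of_le_of_lt ?_ ht)
      rw [pow_succ, mul_assoc]
      exact mul_le_mul_of_nonneg_left hs (pow_nonneg hρ.1.le m)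
  have hlim : Tendsto (fun m : ℕ => ρ ^ m * |t|) atTop (𝓝 0) := by
    simpa using (tendsto_pow_atTop_nhds_zero_of_lt_one hρ.1.le hρ.2).mul_const |t|
  obtain ⟨m, hm⟩ := (hlim.eventually (gt_mem_nhds hδ)).exists
  exact hpow m t hm

section System

variable {p : Matrix (Fin 2) (Fin 2) ℝ} {μ : Fin 2 → ℝ}

lemma pos_of_mem_rowStochastic (hp : p ∈ Matrix.rowStochastic ℝ (Fin 2)) (hlt : ∀ i j, p i j < 1)
    (i j : Fin 2) : 0 < p i j := by
  have hsum := Matrix.sum_row_of_mem_rowStochastic hp i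
  rw [Fin.sum_univ_two] at hsum
  fin_cases j
  · linarith! [hlt i 1]
  · linarith! [hlt i 0]

lemma one_sub_apply_zero (hp : p ∈ Matrix.rowStochastic ℝ (Fin 2)) (i : Fin 2) :
    1 - p i 0 = p i 1 := by
  rw [← Matrix.sum_row_of_mem_rowStochastic hp i, Fin.sum_univ_two, add_sub_cancel_left]

/-- The recursion contracts the argument of the characteristic functions, which agree near `0`. -/
lemma eq_of_eq_mixLaw (hp : p ∈ Matrix.rowStochastic ℝ (Fin 2)) (hlt : ∀ i j, p i j < 1)
    {ν ν' : Fin 2 → Measure ℝ} [∀ i, IsProbabilityMeasure (ν i)]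
    [∀ i, IsProbabilityMeasure (ν' i)] (h : ∀ i, ν i = mixLaw (p i 0) (ν 0) (ν 1))
    (h' : ∀ i, ν' i = mixLaw (p i 0) (ν' 0) (ν' 1)) (i : Fin 2) : ν i = ν' i := by
  have hnonneg : ∀ i j, 0 ≤ p i j := fun i j => Matrix.nonneg_of_mem_rowStochastic hp
  obtain ⟨ρ, hρ, hpρ⟩ := exists_entries_le hlt
  have hclose : ∀ ε > 0, ∀ t i, ‖charFun (ν i) t - charFun (ν' i) t‖ ≤ ε := by
    intro ε hε
    refine forall_of_eventually_of_contraction hρ (eventually_all.mpr fun i => ?_) fun t ht i => ?_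
    · have hcont : Continuous fun t => ‖charFun (ν i) t - charFun (ν' i) t‖ :=
        (continuous_charFun.sub continuous_charFun).norm
      exact hcont.continuousAt.eventually_le_const (by simpa using hε)
    · have hsmall : ∀ j, ‖charFun (ν j) (p i j * t) - charFun (ν' j) (p i j * t)‖ ≤ ε := by
        refine fun j => ht _ ?_ j
        rw [abs_mul, abs_of_nonneg (hnonneg i j)]
        exact mul_le_mul_of_nonneg_right (hpρ i j) (abs_nonneg t)
      rw [h i, h' i]
      refine (norm_charFun_mixLaw_sub_le ⟨hnonneg i 0, (hlt i 0).le⟩ t).trans ?_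
      calc _ ≤ p i 0 * ε + (1 - p i 0) * ε := by
            rw [one_sub_apply_zero hp]
            gcongr
            exacts [hnonneg i 0, hsmall 0, hnonneg i 1, hsmall 1]
        _ = ε := by ring
  refine Measure.ext_of_charFun (funext fun t => sub_eq_zero.mp (norm_le_zero_iff.mp ?_))
  exact le_of_forall_pos_le_add fun ε hε => by simpa using hclose ε hε t i

lemma kappaDenom_eq_mul (p : Matrix (Fin 2) (Fin 2) ℝ) :
    kappaDenom p = 2 * (p 0 0 + p 1 1) * ((1 - p 0 0) * (1 - p 1 1)) := by
  rw [kappaDenom]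
  ring

lemma kappaDenom_pos (hpos : ∀ i j, 0 < p i j) (hlt : ∀ i j, p i j < 1) : 0 < kappaDenom p := by
  rw [kappaDenom_eq_mul]
  have := hpos 0 0
  have := hpos 1 1
  have := sub_pos.mpr (hlt 0 0)
  have := sub_pos.mpr (hlt 1 1)
  positivity

lemma kappa0_pos (hpos : ∀ i j, 0 < p i j) (hlt : ∀ i j, p i j < 1) : 0 < kappa0 p := by
  refine div_pos ?_ (kappaDenom_pos hpos hlt)
  nlinarith [hpos 1 1, hlt 1 1, sq_nonneg (p 0 1)]

lemma kappa1_pos (hpos : ∀ i j, 0 < p i j) (hlt : ∀ i j, p i j < 1) : 0 < kappa1 p := by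
  refine div_pos ?_ (kappaDenom_pos hpos hlt)
  nlinarith [hpos 0 0, hlt 0 0, sq_nonneg (p 1 0)]

lemma kappa_pos (hpos : ∀ i j, 0 < p i j) (hlt : ∀ i j, p i j < 1) : 0 < kappa μ p := by
  have := kappa0_pos hpos hlt
  have := kappa1_pos hpos hlt
  rw [kappa]
  positivity

lemma eq_kappa_of_mean_equations (hp : p ∈ Matrix.rowStochastic ℝ (Fin 2))
    (hlt : ∀ i j, p i j < 1) {m : Fin 2 → ℝ}
    (hm : ∀ i, m i = p i 0 ^ 2 * m 0 + (1 - p i 0) ^ 2 * m 1 + 1) :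
    m 0 = kappa0 p ∧ m 1 = kappa1 p := by
  have hdenom := kappaDenom_pos (pos_of_mem_rowStochastic hp hlt) hlt
  have hp01 : p 0 1 = 1 - p 0 0 := (one_sub_apply_zero hp 0).symm
  have hp10 : p 1 0 = 1 - p 1 1 := by linarith [one_sub_apply_zero hp 1]
  have hm0 := hm 0
  have hm1 := hm 1
  rw [hp10] at hm1
  rw [kappa0, kappa1, eq_div_iff hdenom.ne', eq_div_iff hdenom.ne', kappaDenom, hp01, hp10]
  constructor
  · linear_combination (1 - p 1 1 ^ 2) * hm0 + (1 - p 0 0) ^ 2 * hm1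
  · linear_combination (1 - p 1 1) ^ 2 * hm0 + (1 - p 0 0 ^ 2) * hm1

lemma IsIntegrableSolution.integral_eq_kappa {ν : Fin 2 → ProbabilityMeasure ℝ}
    (h : IsIntegrableSolution p ν) (hp : p ∈ Matrix.rowStochastic ℝ (Fin 2))
    (hlt : ∀ i j, p i j < 1) :
    ∫ x, x ∂(ν 0 : Measure ℝ) = kappa0 p ∧ ∫ x, x ∂(ν 1 : Measure ℝ) = kappa1 p := by
  refine eq_kappa_of_mean_equations (m := fun i => ∫ x, x ∂(ν i : Measure ℝ)) hp hlt fun i => ?_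
  rw [(h i).2, integral_id_mixLaw
    ⟨Matrix.nonneg_of_mem_rowStochastic hp, (hlt i 0).le⟩ (h 0).1 (h 1).1]

lemma IsIntegrableSolution.integral_mixLaw_eq_kappa {ν : Fin 2 → ProbabilityMeasure ℝ}
    (h : IsIntegrableSolution p ν) (hμ : μ ∈ stdSimplex ℝ (Fin 2))
    (hp : p ∈ Matrix.rowStochastic ℝ (Fin 2)) (hlt : ∀ i j, p i j < 1) :
    ∫ x, x ∂mixLaw (μ 0) (ν 0 : Measure ℝ) (ν 1 : Measure ℝ) = kappa μ p := by
  rw [integral_id_mixLaw (mem_Icc_of_mem_stdSimplex hμ 0) (h 0).1 (h 1).1,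
    (h.integral_eq_kappa hp hlt).1, (h.integral_eq_kappa hp hlt).2, kappa]

end System

/-! ### The limit law -/

section CostLaw

variable {α : Type*} [MeasurableSpace α]

lemma identDistrib_toReal_div {Ω : Type*} [MeasurableSpace Ω] {P : Measure Ω} {V : Ω → ℝ≥0∞}
    {κ : Measure (ℕ → α)} {n : ℕ}
    (hV : IdentDistrib V (fun q => (streamCost n q : ℝ≥0∞)) P (streamLaw κ)) :
    IdentDistrib (fun ω => (V ω).toReal / (n + 1 : ℕ))
      (fun q => (streamCost n q : ℝ) / (n + 1 : ℕ)) P (streamLaw κ) :=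
  hV.comp (ENNReal.measurable_toReal.div_const _)

variable [DiscreteMeasurableSpace α] [Countable α]
  {κ : Measure (ℕ → α)} [IsProbabilityMeasure κ]

/-- The law of `Z_μ`: the path cost of a string with law `κ` in a crowd of strings with law `κ`. -/
def costLaw (κ : Measure (ℕ → α)) [IsProbabilityMeasure κ] : ProbabilityMeasure ℝ :=
  ⟨κ.map (pathCost κ), Measure.isProbabilityMeasure_map measurable_pathCost.aemeasurable⟩

lemma coe_costLaw : (costLaw κ : Measure ℝ) = κ.map (pathCost κ) := rfl

lemma HasGeometricCylinders.integrable_pow_costLaw (hκ : HasGeometricCylinders κ) (k : ℕ) :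
    Integrable (fun x => x ^ k) (costLaw κ : Measure ℝ) :=
  (integrable_map_measure (by fun_prop) measurable_pathCost.aemeasurable).mpr
    (hκ.integrable_pathCost_pow k)

lemma identDistrib_pathCost_costLaw :
    IdentDistrib (fun q => pathCost κ q.1) (fun x : ℝ => x) (streamLaw κ)
      (costLaw κ : Measure ℝ) where
  aemeasurable_fst := (measurable_pathCost.comp measurable_fst).aemeasurable
  aemeasurable_snd := aemeasurable_id
  map_eq := by
    have hfst : (streamLaw κ).map Prod.fst = κ := by simp [streamLaw, Measure.map_fst_prod]
    rw [Measure.map_id', coe_costLaw]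
    nth_rw 4 [← hfst]
    exact (Measure.map_map measurable_pathCost measurable_fst).symm

variable {Ω : ℕ → Type*} [∀ n, MeasurableSpace (Ω n)] {P : (n : ℕ) → Measure (Ω n)}
  {W : (n : ℕ) → Ω n → ℝ≥0∞}

lemma tendstoInDistribution_costLaw [∀ n, IsProbabilityMeasure (P n)] (hκ : HasGeometricCylinders κ)
    (hmeas : ∀ n, Measurable (W n))
    (hW : ∀ n,
      IdentDistrib (W (n + 1)) (fun q => (streamCost n q : ℝ≥0∞)) (P (n + 1)) (streamLaw κ)) :
    TendstoInDistribution (fun n ω => (W n ω).toReal / n) atTop (fun x : ℝ => x) P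
      (costLaw κ : Measure ℝ) where
  forall_aemeasurable n := ((hmeas n).ennreal_toReal.div_const _).aemeasurable
  tendsto := by
    have hlim := (tendstoInDistribution_of_ae_tendsto
      (fun n => (identDistrib_toReal_div (hW n)).aemeasurable_snd)
      identDistrib_pathCost_costLaw.aemeasurable_fst (ae_tendsto_streamCost_div hκ)).tendsto
    simp only [← (identDistrib_toReal_div (hW _)).map_eq, identDistrib_pathCost_costLaw.map_eq]
      at hlim
    exact (tendsto_add_atTop_iff_nat 1).mp hlim

lemma tendsto_moment_costLaw (hκ : HasGeometricCylinders κ)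
    (hW : ∀ n,
      IdentDistrib (W (n + 1)) (fun q => (streamCost n q : ℝ≥0∞)) (P (n + 1)) (streamLaw κ))
    (k : ℕ) :
    Tendsto (fun n : ℕ => ∫ ω, ((W n ω).toReal / n) ^ k ∂(P n)) atTop
      (𝓝 (∫ x, x ^ k ∂(costLaw κ : Measure ℝ))) := by
  have hpow : Measurable fun x : ℝ => x ^ k := by fun_prop
  have hlim := tendsto_integral_of_uniformIntegrable (uniformIntegrable_streamCost_div_pow hκ k)
    ((ae_tendsto_streamCost_div hκ).mono fun q hq => hq.pow k)
  have hmoment : ∫ q, pathCost κ q.1 ^ k ∂streamLaw κ = ∫ x, x ^ k ∂(costLaw κ : Measure ℝ) :=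
    (identDistrib_pathCost_costLaw.comp hpow).integral_eq
  rw [hmoment] at hlim
  exact (tendsto_add_atTop_iff_nat 1).mp (hlim.congr fun n =>
    ((identDistrib_toReal_div (hW n)).comp hpow).integral_eq.symm)

lemma HasGeometricCylinders.integrable_streamCost_pow (hκ : HasGeometricCylinders κ) (n k : ℕ) :
    Integrable (fun q => (streamCost n q : ℝ) ^ k) (streamLaw κ) := by
  have hint := memLp_one_iff_integrable.mp ((uniformIntegrable_streamCost_div_pow hκ k).memLp n)
  have hne : ((n + 1 : ℕ) : ℝ) ≠ 0 := Nat.cast_ne_zero.mpr n.succ_ne_zero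
  refine (hint.mul_const (((n + 1 : ℕ) : ℝ) ^ k)).congr (Eventually.of_forall fun q => ?_)
  simp only [← mul_pow, div_mul_cancel₀ _ hne]

end CostLaw

section Limit

variable {p : Matrix (Fin 2) (Fin 2) ℝ} {μ : Fin 2 → ℝ} {κ : Measure (ℕ → Fin 2)}

lemma IsChainLaw.costLaw_eq_mixLaw [IsProbabilityMeasure κ] (h : IsChainLaw p μ κ)
    (hμ : μ ∈ stdSimplex ℝ (Fin 2)) (hp : ∀ i j, 0 ≤ p i j) (hlt : ∀ i j, p i j < 1)
    {κr : Fin 2 → Measure (ℕ → Fin 2)} [∀ i, IsProbabilityMeasure (κr i)]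
    (hr : ∀ i, IsChainLaw p (p i) (κr i)) :
    (costLaw κ : Measure ℝ) = mixLaw (μ 0) (costLaw (κr 0)) (costLaw (κr 1)) := by
  have hμ1 : 1 - μ 0 = μ 1 := by
    rw [← hμ.2, Fin.sum_univ_two, add_sub_cancel_left]
  rw [mixLaw_eq, hμ1, coe_costLaw, h.map_pathCost hμ hp hlt hr, Fin.sum_univ_two]
  rfl

lemma IsChainLaw.exists_isIntegrableSolution [IsProbabilityMeasure κ] (h : IsChainLaw p μ κ)
    (hμ : μ ∈ stdSimplex ℝ (Fin 2)) (hp : p ∈ Matrix.rowStochastic ℝ (Fin 2))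
    (hlt : ∀ i j, p i j < 1) :
    ∃ ν : Fin 2 → ProbabilityMeasure ℝ, IsIntegrableSolution p ν ∧
      (costLaw κ : Measure ℝ) = mixLaw (μ 0) (ν 0 : Measure ℝ) (ν 1 : Measure ℝ) := by
  have hpos := pos_of_mem_rowStochastic hp hlt
  have hnonneg : ∀ i j, 0 ≤ p i j := fun i j => (hpos i j).le
  have hrow : ∀ i, p i ∈ stdSimplex ℝ (Fin 2) := fun i =>
    ⟨hnonneg i, Matrix.sum_row_of_mem_rowStochastic hp i⟩
  have hmass : ∀ j, 0 < ∑ i, μ i * p i j := by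
    intro j
    obtain ⟨i, -, hi⟩ := Finset.exists_lt_of_sum_lt (f := 0) (g := μ) (s := Finset.univ)
      (by simp [hμ.2])
    exact Finset.sum_pos' (fun i _ => mul_nonneg (hμ.1 i) (hnonneg i j))
      ⟨i, Finset.mem_univ i, mul_pos hi (hpos i j)⟩
  choose κr hr using fun i => h.exists_row hμ.1 hnonneg i (hmass i)
  have := fun i => (hr i).isProbabilityMeasure
  refine ⟨fun i => costLaw (κr i), fun i => ⟨?_, ?_⟩, h.costLaw_eq_mixLaw hμ hnonneg hlt hr⟩
  · have hgeom := (hr i).hasGeometricCylinders (fun j => (hlt i j).le) hnonneg hlt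
    simpa only [pow_one] using hgeom.integrable_pow_costLaw 1
  · exact (hr i).costLaw_eq_mixLaw (hrow i) hnonneg hlt hr

lemma IsIntegrableSolution.unique {ν ν' : Fin 2 → ProbabilityMeasure ℝ}
    (h : IsIntegrableSolution p ν) (h' : IsIntegrableSolution p ν')
    (hp : p ∈ Matrix.rowStochastic ℝ (Fin 2)) (hlt : ∀ i j, p i j < 1) : ν = ν' :=
  funext fun i => ProbabilityMeasure.toMeasure_injective <|
    eq_of_eq_mixLaw hp hlt (ν := fun i => ν i) (ν' := fun i => ν' i)
      (fun i => (h i).2) (fun i => (h' i).2) i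

lemma bucketOps_fin_zero (x : Fin 0 → ℕ → Fin 2) (ℓ : ℕ) : bucketOps x ℓ = 0 := by
  have hcard : ∀ k, (state x ℓ k).1.card = 0 := fun k => by
    rw [Finset.eq_empty_of_isEmpty (state x ℓ k).1, Finset.card_empty]
  simp [bucketOps, hcard]

namespace IsUniformRankModel

variable {Ω : Type*} [MeasurableSpace Ω] {P : Measure Ω} {n : ℕ}
  {X : Fin n → Ω → ℕ → Fin 2} {R : Ω → ℕ}

lemma measurable_cost (h : IsUniformRankModel P μ p n X R) :
    Measurable fun ω => bucketOps (fun i => X i ω) (R ω) :=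
  measurable_bucketOps.comp ((measurable_pi_lambda _ h.measurable_data).prodMk h.measurable_rank)

variable [IsProbabilityMeasure P] [IsProbabilityMeasure κ]

lemma identDistrib_streamCost {X : Fin (n + 1) → Ω → ℕ → Fin 2}
    (h : IsUniformRankModel P μ p (n + 1) X R) (hκ : IsChainLaw p μ κ)
    (hgeom : HasGeometricCylinders κ) :
    IdentDistrib (fun ω => bucketOps (fun i => X i ω) (R ω))
      (fun q => (streamCost n q : ℝ≥0∞)) P (streamLaw κ) := by
  have := hgeom.nullSingletonClass
  exact h.identDistrib_bucketOps fun i =>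
    ((h.markov_data i).isChainLaw (h.measurable_data i)).unique hκ

lemma ae_cost_lt_top (h : IsUniformRankModel P μ p n X R)
    (hκ : IsChainLaw p μ κ) (hgeom : HasGeometricCylinders κ) :
    ∀ᵐ ω ∂P, bucketOps (fun i => X i ω) (R ω) < ∞ := by
  cases n with
  | zero => simp [bucketOps_fin_zero]
  | succ n =>
    exact (h.identDistrib_streamCost hκ hgeom).symm.ae_snd measurableSet_Iio
      (Eventually.of_forall fun q => ENNReal.natCast_lt_top _)

lemma integrable_cost_pow (h : IsUniformRankModel P μ p n X R)
    (hκ : IsChainLaw p μ κ) (hgeom : HasGeometricCylinders κ) (k : ℕ) :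
    Integrable (fun ω => (bucketOps (fun i => X i ω) (R ω)).toReal ^ k) P := by
  cases n with
  | zero => simp [bucketOps_fin_zero]
  | succ n =>
    exact ((h.identDistrib_streamCost hκ hgeom).comp
      (ENNReal.measurable_toReal.pow_const k)).integrable_iff.mpr
        (hgeom.integrable_streamCost_pow n k)

end IsUniformRankModel

end Limit

lemma isLittleO_sub_of_tendsto_div {a : ℕ → ℝ} {c : ℝ}
    (h : Tendsto (fun n => a n / n) atTop (𝓝 c)) :
    (fun n => a n - c * n) =o[atTop] fun n : ℕ => (n : ℝ) := by
  have hne : ∀ᶠ n : ℕ in atTop, (n : ℝ) ≠ 0 :=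
    (eventually_ne_atTop 0).mono fun n => Nat.cast_ne_zero.mpr
  refine (Asymptotics.isLittleO_iff_tendsto' (hne.mono fun n hn h0 => absurd h0 hn)).mpr ?_
  refine (tendsto_sub_nhds_zero_iff.mpr h).congr' (hne.mono fun n hn => ?_)
  simp only [sub_div, mul_div_cancel_right₀ c hn]

end RadixSelection

end

open RadixSelection in
theorem theorem3p5
    (μ : Fin 2 → ℝ) (hμ : μ ∈ stdSimplex ℝ (Fin 2))
    (p : Matrix (Fin 2) (Fin 2) ℝ) (hp : p ∈ Matrix.rowStochastic ℝ (Fin 2))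
    (hp_lt : ∀ i j, p i j < 1)
    {Ω : ℕ → Type*} [∀ n, MeasurableSpace (Ω n)]
    (P : (n : ℕ) → Measure (Ω n)) [∀ n, IsProbabilityMeasure (P n)]
    (X : (n : ℕ) → Fin n → Ω n → ℕ → Fin 2) (R : (n : ℕ) → Ω n → ℕ)
    (hmodel : ∀ n, RadixSelection.IsUniformRankModel (P n) μ p n (X n) (R n))
    (W : (n : ℕ) → Ω n → ℝ≥0∞)
    (hW : ∀ n ω, W n ω = RadixSelection.bucketOps (fun i => X n i ω) (R n ω)) :
    -- the complexity is almost surely finite and its mean is `κ_μ n + o(n)`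
    (∀ n, ∀ᵐ ω ∂(P n), W n ω < ∞) ∧
    (∀ n, Integrable (fun ω => (W n ω).toReal) (P n)) ∧
    0 < RadixSelection.kappa μ p ∧
    (fun n : ℕ => (∫ ω, (W n ω).toReal ∂(P n)) - RadixSelection.kappa μ p * n)
      =o[atTop] (fun n : ℕ => (n : ℝ)) ∧
    -- `ν 0, ν 1` are the laws of `Z⁰, Z¹`, and `ζ` is the law of `Z_μ`
    ∃ (ν : Fin 2 → ProbabilityMeasure ℝ) (ζ : ProbabilityMeasure ℝ),
      RadixSelection.IsIntegrableSolution p ν ∧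
      (∀ ν', RadixSelection.IsIntegrableSolution p ν' → ν' = ν) ∧
      (0 < RadixSelection.kappa0 p ∧ ∫ x, x ∂(ν 0 : Measure ℝ) = RadixSelection.kappa0 p) ∧
      (0 < RadixSelection.kappa1 p ∧ ∫ x, x ∂(ν 1 : Measure ℝ) = RadixSelection.kappa1 p) ∧
      (ζ : Measure ℝ) = RadixSelection.mixLaw (μ 0) (ν 0 : Measure ℝ) (ν 1 : Measure ℝ) ∧
      -- convergence in distribution of `W_n / n`, with all moments
      TendstoInDistribution (fun n ω => (W n ω).toReal / n) atTop (fun x : ℝ => x) P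
        (ζ : Measure ℝ) ∧
      ∀ k : ℕ,
        (∀ n, Integrable (fun ω => ((W n ω).toReal / n) ^ k) (P n)) ∧
        Integrable (fun x : ℝ => x ^ k) (ζ : Measure ℝ) ∧
        Tendsto (fun n : ℕ => ∫ ω, ((W n ω).toReal / n) ^ k ∂(P n)) atTop
          (𝓝 (∫ x, x ^ k ∂(ζ : Measure ℝ))) := by
  obtain rfl : W = fun n ω => bucketOps (fun i => X n i ω) (R n ω) := funext₂ hW
  have hpos := pos_of_mem_rowStochastic hp hp_lt
  have hchain := ((hmodel 1).markov_data 0).isChainLaw ((hmodel 1).measurable_data 0)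
  have hgeom := hchain.hasGeometricCylinders (fun a => (mem_Icc_of_mem_stdSimplex hμ a).2)
    (fun i j => (hpos i j).le) hp_lt
  have := hchain.isProbabilityMeasure
  have hcost := fun n => (hmodel (n + 1)).identDistrib_streamCost hchain hgeom
  have hmoment := tendsto_moment_costLaw
    (W := fun n ω => bucketOps (fun i => X n i ω) (R n ω)) hgeom hcost
  have hint := fun n => (hmodel n).integrable_cost_pow hchain hgeom
  obtain ⟨ν, hν, hζ⟩ := hchain.exists_isIntegrableSolution hμ hp hp_lt
  have hmean := hν.integral_eq_kappa hp hp_lt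
  refine ⟨fun n => (hmodel n).ae_cost_lt_top hchain hgeom, fun n => by simpa using hint n 1,
    kappa_pos hpos hp_lt, isLittleO_sub_of_tendsto_div ?_, ν, costLaw _, hν,
    fun ν' hν' => hν'.unique hν hp hp_lt, ⟨kappa0_pos hpos hp_lt, hmean.1⟩,
    ⟨kappa1_pos hpos hp_lt, hmean.2⟩, hζ,
    tendstoInDistribution_costLaw hgeom (fun n => (hmodel n).measurable_cost) hcost,
    fun k => ⟨fun n => ?_, hgeom.integrable_pow_costLaw k, hmoment k⟩⟩
  · simpa only [pow_one, integral_div, hζ, hν.integral_mixLaw_eq_kappa hμ hp hp_lt] using hmoment 1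
  · simpa only [div_pow] using (hint n k).div_const _
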